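/- Binary strings are finite, $\log$ is base $2$. A \emph{prefix-free machine} is a partial computable function $U(p,x)$ from pairs of strings to strings such that for every $x$ the set of $p$ for which $U(p,x)$ is defined contains no string together with a proper prefix of it. For an infinite binary sequence $\pi$, write $U(\pi,x)=y$ if $U(p,x)=y$ for some prefix $p$ of $\pi$. Let $\pi$ be a sequence of independent uniformly random bits and put $$e_U(x,y)=\Pr_\pi[U(\pi,x)=y \text{ and } U(\pi,y)=x].$$ A prefix-free machine $U$ is \emph{$e$-optimal} if for every prefix-free machine $U'$ there is $c>0$ with $e_{U'}\le c\,e_U$ everywhere. Let $K_V(y|x)=\min\{|p| : V(p,x)=y\}$ ($\infty$ if there is no such $p$); a prefix-free machine $V$ is \emph{complexity-optimal} if for every prefix-free machine $V'$ there is $c$ with $K_V\le K_{V'}+c$ everywhere, and then $\mathrm{KP}(y|x)=K_V(y|x)$ is the conditional prefix complexity. A \emph{lower semicomputable conditional semimeasure} is a function $m(y|x)\ge 0$ that is the limit of a nondecreasing sequence of rationals computable uniformly in $x,y$, with $\sum_y m(y|x)\le 1$ for every $x$; it is \emph{maximal} if every other one is bounded by a constant multiple of it. Theorem. $e$-optimal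 machines, complexity-optimal machines and maximal lower semicomputable conditional semimeasures exist. Let $U$ be $e$-optimal, $e=e_U$, let $\mathrm{KP}$ be given by a complexity-optimal machine, let $m$ be a maximal lower semicomputable conditional semimeasure, and let $u(x,y)=\min(m(x|y),m(y|x))$. 1. For all strings $x,y$, the values $-\log e(x,y)$, $\mathrm{KP}(x|y)$ and $\mathrm{KP}(y|x)$ are finite, and $$-\log e(x,y)=\max(\mathrm{KP}(x|y),\mathrm{KP}(y|x))+O(1),$$ where the $O(1)$ constant does not depend on $x,y$. 2. Equivalently, $e(x,y)$ and $u(x,y)$ coincide up to a constant factor that does not depend on $x,y$. 3. There is a family of subsets $S_{x,y}$ of $\{0,1\}^{\mathbb N}$, indexed by pairs of strings, that is uniformly effectively open (each $S_{x,y}$ is a union of intervals $[p]=\{\pi : p \text{ is a prefix of } \pi\}$, where $p$ ranges over a set of strings that is computably enumerable uniformly in $x,y$), symmetric ($S_{x,y}=S_{y,x}$), disjoint for a fixed first index ($S_{x,y}\cap S_{x,z}=\emptyset$ if $y\ne z$), and such that the uniform measure of $S_{x,y}$ is exactly $u(x,y)/2$. Moreover, there is a prefix-free machine $W$ with $S_{x,y}=\{\pi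 : W(\pi,x)=y \text{ and } W(\pi,y)=x\}$ for all $x,y$. -/

import Mathlib

open MeasureTheory Filter Topology

namespace InfoDist

/-- Binary strings. -/
abbrev Str := List Bool

/-- The Cantor space of infinite binary sequences. -/
abbrev Cantor := ℕ → Bool

/-- A machine `U(p, x)` is a partial function of a program `p` and an input `x`. -/
abbrev Machine := Str → Str →. Str

/-- For every input `x`, the domain of `U(·, x)` does not contain a string together with one of
its proper prefixes. -/
def PrefixFree (U : Machine) : Prop :=
  ∀ x p p' : Str, p <+: p' → (U p x).Dom → (U p' x).Dom → p = p'

/-- Computable partial prefix-free functions of two string arguments. -/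
def IsPrefixFreeMachine (U : Machine) : Prop :=
  Partrec₂ U ∧ PrefixFree U

/-- The law of a sequence of independent uniformly distributed random bits. -/
noncomputable def coinMeasure : Measure Cantor :=
  Measure.infinitePi fun _ : ℕ => (PMF.uniformOfFintype Bool).toMeasure

/-- The interval `[p]`: all infinite sequences that have the string `p` as a prefix. -/
def interval (p : Str) : Set Cantor :=
  {π | ∀ i : Fin p.length, π i = p.get i}

/-- The event `U(π, x) = y`: some prefix `p` of `π` satisfies `U(p, x) = y`. -/
def mapsEvent (U : Machine) (x y : Str) : Set Cantor :=
  {π | ∃ p : Str, π ∈ interval p ∧ y ∈ U p x}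

/-- The event `U(π, x) = y` and `U(π, y) = x` (the two prefixes of `π` may differ). -/
def backForthEvent (U : Machine) (x y : Str) : Set Cantor :=
  mapsEvent U x y ∩ mapsEvent U y x

/-- The probability `e_U(x, y)` that a random sequence maps `x` to `y` and also `y` to `x`. -/
noncomputable def backForthProb (U : Machine) (x y : Str) : ℝ :=
  coinMeasure.real (backForthEvent U x y)

/-- `U` is a prefix-free machine that makes `e_U` maximal up to a constant factor. -/
def IsBackForthOptimal (U : Machine) : Prop :=
  IsPrefixFreeMachine U ∧
    ∀ U' : Machine, IsPrefixFreeMachine U' →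
      ∃ c : ℝ, 0 < c ∧ ∀ x y : Str, backForthProb U' x y ≤ c * backForthProb U x y

/-- `condComplexity V y x` is the minimal length of a program `p` with `V(p, x) = y`
(and `⊤` if there is none), the complexity of `y` given `x` with respect to `V`. -/
noncomputable def condComplexity (V : Machine) (y x : Str) : ℕ∞ :=
  ⨅ (p : Str) (_ : y ∈ V p x), (p.length : ℕ∞)

/-- `V` is a prefix-free machine that makes the complexity minimal up to an additive constant;
then `condComplexity V y x` is the conditional prefix complexity `KP(y | x)`. -/
def IsComplexityOptimal (V : Machine) : Prop :=
  IsPrefixFreeMachine V ∧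
    ∀ V' : Machine, IsPrefixFreeMachine V' →
      ∃ c : ℕ, ∀ x y : Str, condComplexity V y x ≤ condComplexity V' y x + c

/-- A non-negative function is lower semicomputable if it is the limit of a nondecreasing sequence
of non-negative rationals that is computable uniformly in the arguments. -/
def LowerSemicomputable (f : Str → Str → ℝ) : Prop :=
  ∃ num den : ℕ × Str × Str → ℕ, Computable num ∧ Computable den ∧
    ∀ x y : Str,
      Monotone (fun n => (num (n, x, y) : ℝ) / ((den (n, x, y) : ℝ) + 1)) ∧
      Tendsto (fun n => (num (n, x, y) : ℝ) / ((den (n, x, y) : ℝ) + 1)) atTop (𝓝 (f x y))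

/-- Lower semicomputable conditional semimeasures; `m y x` stands for `m(y | x)`. -/
def IsCondSemimeasure (m : Str → Str → ℝ) : Prop :=
  LowerSemicomputable m ∧ (∀ y x, 0 ≤ m y x) ∧
    ∀ x, Summable (fun y => m y x) ∧ ∑' y, m y x ≤ 1

/-- A lower semicomputable conditional semimeasure that is maximal up to a constant factor. -/
def IsMaximalCondSemimeasure (m : Str → Str → ℝ) : Prop :=
  IsCondSemimeasure m ∧
    ∀ m' : Str → Str → ℝ, IsCondSemimeasure m' →
      ∃ c : ℝ, 0 < c ∧ ∀ y x : Str, m' y x ≤ c * m y x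

/-- The sets `S x y` are unions of intervals that are enumerable uniformly in `x` and `y`. -/
def UniformlyEffectivelyOpen (S : Str → Str → Set Cantor) : Prop :=
  ∃ A : Str × Str × Str → Prop, REPred A ∧
    ∀ x y : Str, S x y = ⋃ (p : Str) (_ : A (x, y, p)), interval p

end InfoDist

open scoped ENNReal NNReal
open Encodable Denumerable

namespace InfoDist

/-! ### Computability of elementary constructions -/

section Computability

variable {α β σ : Type*} [Primcodable α] [Primcodable β] [Primcodable σ]

theorem Computable.ite' {c : α → Prop} [DecidablePred c] {f g : α → σ}
    (hc : Computable fun a => decide (c a)) (hf : Computable f) (hg : Computable g) :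
    Computable fun a => if c a then f a else g a :=
  (Computable.cond hc hf hg).of_eq fun a => by by_cases h : c a <;> simp [h]

theorem Computable.decide_lt {f g : α → ℕ} (hf : Computable f) (hg : Computable g) :
    Computable fun a => decide (f a < g a) :=
  Primrec.nat_lt.decide.to_comp.comp hf hg

theorem Computable.decide_le {f g : α → ℕ} (hf : Computable f) (hg : Computable g) :
    Computable fun a => decide (f a ≤ g a) :=
  Primrec.nat_le.decide.to_comp.comp hf hg

theorem Computable.decide_eq [DecidableEq β] {f g : α → β} (hf : Computable f)
    (hg : Computable g) : Computable fun a => decide (f a = g a) :=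
  Primrec.eq.decide.to_comp.comp hf hg

theorem Computable.decide_and {p q : α → Prop} [DecidablePred p] [DecidablePred q]
    (hp : Computable fun a => decide (p a)) (hq : Computable fun a => decide (q a)) :
    Computable fun a => decide (p a ∧ q a) :=
  (Primrec.and.to_comp.comp hp hq).of_eq fun a => by simp

theorem Computable.decide_not {p : α → Prop} [DecidablePred p]
    (hp : Computable fun a => decide (p a)) : Computable fun a => decide (¬ p a) :=
  (Primrec.not.to_comp.comp hp).of_eq fun a => by simp

theorem Computable.nat_add {f g : α → ℕ} (hf : Computable f) (hg : Computable g) :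
    Computable fun a => f a + g a :=
  Primrec.nat_add.to_comp.comp hf hg

theorem Computable.nat_sub {f g : α → ℕ} (hf : Computable f) (hg : Computable g) :
    Computable fun a => f a - g a :=
  Primrec.nat_sub.to_comp.comp hf hg

theorem Computable.nat_mul {f g : α → ℕ} (hf : Computable f) (hg : Computable g) :
    Computable fun a => f a * g a :=
  Primrec.nat_mul.to_comp.comp hf hg

theorem Computable.nat_div {f g : α → ℕ} (hf : Computable f) (hg : Computable g) :
    Computable fun a => f a / g a :=
  Primrec.nat_div.to_comp.comp hf hg

theorem Primrec.nat_pow' : Primrec₂ ((· ^ ·) : ℕ → ℕ → ℕ) :=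
  Primrec₂.unpaired'.1 Nat.Primrec.pow

theorem Computable.two_pow {f : α → ℕ} (hf : Computable f) : Computable fun a => 2 ^ f a :=
  Primrec.nat_pow'.to_comp.comp (Computable.const 2) hf

theorem Computable.unpair_fst {f : α → ℕ} (hf : Computable f) :
    Computable fun a => (f a).unpair.1 :=
  (Computable.fst.comp Computable.unpair).comp hf

theorem Computable.unpair_snd {f : α → ℕ} (hf : Computable f) :
    Computable fun a => (f a).unpair.2 :=
  (Computable.snd.comp Computable.unpair).comp hf

/-- Every partial computable function has a step-by-step evaluation that shows its value at
exactly one step. -/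
theorem exists_evaluation {f : α →. σ} (hf : Partrec f) :
    ∃ g : α → ℕ → Option σ, Computable₂ g ∧ ∀ a,
      (∀ s ∈ f a, ∃ t, g a t = some s ∧ ∀ t' ≠ t, g a t' = none) ∧
      ((∀ s, s ∉ f a) → ∀ t, g a t = none) := by
  obtain ⟨c, hc⟩ := Nat.Partrec.Code.exists_code.1 hf
  have hev : ∀ a, Nat.Partrec.Code.eval c (encode a) = (f a).map encode := by
    intro a
    rw [hc]
    simp
  let e : α → ℕ → Option ℕ := fun a t => Nat.Partrec.Code.evaln t c (encode a)
  have he : Computable₂ e :=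
    (Nat.Partrec.Code.primrec_evaln.to_comp.comp
      (Computable.pair (Computable.pair Computable.snd (Computable.const c))
        (Computable.encode.comp Computable.fst)))
  -- The value is shown at `t` only if bound `t` fails and bound `t + 1` succeeds. By monotonicity
  -- in the bound this happens at most once, so a sum over `t` counts the value once.
  refine ⟨fun a t => if (e a t).isSome = true then none else (e a (t + 1)).bind (decode (α := σ)),
    ?_, ?_⟩
  · refine Computable.ite' (σ := Option σ) (c := fun p : α × ℕ => (e p.1 p.2).isSome = true) ?_
      (Computable.const none) ?_
    · exact (Primrec.option_isSome.to_comp.comp he).of_eq fun p => by simp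
    · exact Computable.option_bind (he.comp Computable.fst (Computable.succ.comp Computable.snd))
        (Computable.decode.comp Computable.snd)
  · intro a
    constructor
    · intro s hs
      have hm : encode s ∈ Nat.Partrec.Code.eval c (encode a) := by
        rw [hev]; exact Part.mem_map _ hs
      have hex : ∃ k, (e a k).isSome = true := by
        obtain ⟨k, hk⟩ := Nat.Partrec.Code.evaln_complete.1 hm
        exact ⟨k, by simp only [e]; rw [Option.mem_def.1 hk]; rfl⟩
      have hval : ∀ k, (e a k).isSome = true → e a k = some (encode s) := by
        intro k hk
        obtain ⟨v, hv⟩ := Option.isSome_iff_exists.1 hk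
        rw [hv, Part.mem_unique (Nat.Partrec.Code.evaln_sound (Option.mem_def.2 hv)) hm]
      have hmono : ∀ j k, j ≤ k → (e a j).isSome = true → (e a k).isSome = true := by
        intro j k hjk hj
        obtain ⟨v, hv⟩ := Option.isSome_iff_exists.1 hj
        have := Nat.Partrec.Code.evaln_mono hjk (Option.mem_def.2 hv)
        exact Option.isSome_iff_exists.2 ⟨v, this⟩
      -- Evaluation with bound `0` never succeeds, so the first success has the form `t + 1`.
      have h0 : Nat.find hex ≠ 0 := by
        intro h
        have := Nat.find_spec hex
        rw [h] at this
        obtain ⟨v, hv⟩ := Option.isSome_iff_exists.1 this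
        exact absurd (Nat.Partrec.Code.evaln_bound (Option.mem_def.2 hv)) (by omega)
      obtain ⟨t, ht⟩ := Nat.exists_eq_succ_of_ne_zero h0
      have ht1 : (e a (t + 1)).isSome = true := by
        have := Nat.find_spec hex
        rwa [ht] at this
      have ht0 : ¬ (e a t).isSome = true := Nat.find_min hex (by omega)
      refine ⟨t, ?_, ?_⟩
      · simp only [if_neg ht0, hval _ ht1]
        simp
      · intro t' ht'
        rcases lt_or_gt_of_ne ht' with h | h
        · have : ¬ (e a (t' + 1)).isSome = true := fun h' => ht0 (hmono _ _ (by omega) h')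
          have h2 : e a (t' + 1) = none := by simpa using this
          simp [h2]
        · have : (e a t').isSome = true := hmono _ _ (by omega) ht1
          simp [this]
    · intro hs t
      have : e a (t + 1) = none := by
        rw [Option.eq_none_iff_forall_not_mem]
        intro v hv
        have := Nat.Partrec.Code.evaln_sound hv
        rw [hev, Part.mem_map_iff] at this
        obtain ⟨s, h, -⟩ := this
        exact hs s h
      simp [this]

end Computability

/-! ### Streams of weights -/

/-- The weight `2 ^ (-k)` of a request of size `k`; no request has weight `0`. -/
noncomputable def wt (o : Option ℕ) : ℝ≥0∞ := o.elim 0 fun k => 2⁻¹ ^ k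

@[simp] theorem wt_none : wt none = 0 := rfl

@[simp] theorem wt_some (k : ℕ) : wt (some k) = 2⁻¹ ^ k := rfl

theorem wt_ne_top (o : Option ℕ) : wt o ≠ ∞ := by
  cases o <;> simp

theorem two_pow_mul_inv (k : ℕ) : (2 : ℝ≥0∞) ^ k * 2⁻¹ ^ k = 1 := by
  rw [← mul_pow, ENNReal.mul_inv_cancel (by norm_num) (by norm_num), one_pow]

theorem tsum_geometric_succ : ∑' n : ℕ, (2⁻¹ : ℝ≥0∞) ^ (n + 1) = 1 := by
  rw [ENNReal.tsum_geometric_add_one, ENNReal.one_sub_inv_two, inv_inv,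
    ENNReal.inv_mul_cancel (by norm_num) (by norm_num)]

/-- The partial sums of a stream of weights as fractions. -/
def acc (q : ℕ → Option ℕ) : ℕ → ℕ × ℕ
  | 0 => (0, 1)
  | n + 1 => (q n).elim (acc q n) fun k =>
      ((acc q n).1 * 2 ^ k + (acc q n).2, (acc q n).2 * 2 ^ k)

theorem acc_snd_pos (q : ℕ → Option ℕ) (n : ℕ) : 0 < (acc q n).2 := by
  induction n with
  | zero => simp [acc]
  | succ n ih => cases h : q n <;> simp [acc, h, ih]

theorem acc_fst_eq (q : ℕ → Option ℕ) (n : ℕ) :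
    ((acc q n).1 : ℝ≥0∞) = (acc q n).2 * ∑ i ∈ Finset.range n, wt (q i) := by
  induction n with
  | zero => simp [acc]
  | succ n ih =>
    rw [Finset.sum_range_succ]
    cases h : q n with
    | none => simp [acc, h, ih]
    | some k =>
      simp only [acc, h, Option.elim, wt_some]
      push_cast
      rw [ih, mul_add, mul_assoc _ (2 ^ k) (2⁻¹ ^ k), two_pow_mul_inv]
      ring

theorem acc_div_eq (q : ℕ → Option ℕ) (n : ℕ) :
    ((acc q n).1 : ℝ) / (acc q n).2 = (∑ i ∈ Finset.range n, wt (q i)).toReal := by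
  have h := congrArg ENNReal.toReal (acc_fst_eq q n)
  rw [ENNReal.toReal_mul] at h
  simp only [ENNReal.toReal_natCast] at h
  have := acc_snd_pos q n
  rw [h]
  field_simp

/-- Turns the test that the weight so far is at most `1` into a comparison of natural numbers, which
`trim` can decide. -/
theorem acc_fst_le_snd_iff (q : ℕ → Option ℕ) (n : ℕ) :
    (acc q n).1 ≤ (acc q n).2 ↔ ∑ i ∈ Finset.range n, wt (q i) ≤ 1 := by
  have h0 : ((acc q n).2 : ℝ≥0∞) ≠ 0 := by exact_mod_cast (acc_snd_pos q n).ne'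
  rw [← Nat.cast_le (α := ℝ≥0∞), acc_fst_eq]
  constructor
  · intro h
    by_contra hc
    push Not at hc
    exact absurd h (not_le.2 (by
      simpa using ENNReal.mul_lt_mul_right h0 (ENNReal.natCast_ne_top _) hc))
  · intro h
    simpa using mul_le_mul_right h ((acc q n).2 : ℝ≥0∞)

theorem computable_acc {α : Type*} [Primcodable α] {q : α → ℕ → Option ℕ} (hq : Computable₂ q) :
    Computable₂ fun a n => acc (q a) n := by
  have hstep : Computable₂ fun (p : α × ℕ) (s : ℕ × ℕ × ℕ) =>
      (q p.1 s.1).elim s.2 fun k => (s.2.1 * 2 ^ k + s.2.2, s.2.2 * 2 ^ k) := by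
    refine (Computable.option_casesOn (α := (α × ℕ) × (ℕ × ℕ × ℕ)) (σ := ℕ × ℕ)
      (o := fun x => q x.1.1 x.2.1) (f := fun x => x.2.2)
      (g := fun x k => (x.2.2.1 * 2 ^ k + x.2.2.2, x.2.2.2 * 2 ^ k)) ?_ ?_ ?_).of_eq ?_
    · exact hq.comp (Computable.fst.comp Computable.fst) (Computable.fst.comp Computable.snd)
    · exact Computable.snd.comp Computable.snd
    · have h1 : Computable fun x : ((α × ℕ) × (ℕ × ℕ × ℕ)) × ℕ => x.1.2.2.1 :=
        Computable.fst.comp (Computable.snd.comp (Computable.snd.comp Computable.fst))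
      have h2 : Computable fun x : ((α × ℕ) × (ℕ × ℕ × ℕ)) × ℕ => x.1.2.2.2 :=
        Computable.snd.comp (Computable.snd.comp (Computable.snd.comp Computable.fst))
      have h3 := Computable.two_pow (Computable.snd (α := (α × ℕ) × (ℕ × ℕ × ℕ)) (β := ℕ))
      exact Computable.pair (Computable.nat_add (Computable.nat_mul h1 h3) h2)
        (Computable.nat_mul h2 h3)
    · rintro ⟨p, s⟩
      cases h : q p.1 s.1 <;> simp [h]
  refine (Computable.nat_rec (Computable.snd (α := α) (β := ℕ))
    (Computable.const ((0, 1) : ℕ × ℕ)) hstep).of_eq ?_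
  rintro ⟨a, n⟩
  simp only
  induction n with
  | zero => rfl
  | succ n ih => rw [acc, ← ih]

/-- The sum of a computable stream of weights is lower semicomputable. -/
theorem lowerSemicomputable_tsum {q : Str × Str → ℕ → Option ℕ} (hq : Computable₂ q)
    (hfin : ∀ a, ∑' n, wt (q a n) ≠ ∞) :
    LowerSemicomputable fun x y => (∑' n, wt (q (x, y) n)).toReal := by
  have hc : Computable fun p : ℕ × Str × Str => acc (q p.2) p.1 :=
    (computable_acc hq).comp Computable.snd Computable.fst
  refine ⟨fun p => (acc (q p.2) p.1).1, fun p => (acc (q p.2) p.1).2 - 1,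
    Computable.fst.comp hc, Computable.nat_sub (Computable.snd.comp hc) (Computable.const 1), ?_⟩
  intro x y
  have heq : (fun n => ((acc (q (x, y)) n).1 : ℝ) / (((acc (q (x, y)) n).2 - 1 : ℕ) + 1 : ℝ)) =
      fun n => (∑ i ∈ Finset.range n, wt (q (x, y) i)).toReal := by
    funext n
    rw [← acc_div_eq, ← Nat.cast_add_one, Nat.sub_add_cancel (acc_snd_pos _ _)]
  have hne : ∀ n, ∑ i ∈ Finset.range n, wt (q (x, y) i) ≠ ∞ := fun n =>
    ne_top_of_le_ne_top (hfin (x, y)) (ENNReal.sum_le_tsum _)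
  simp only
  rw [heq]
  constructor
  · intro m n hmn
    exact ENNReal.toReal_mono (hne n) (Finset.sum_le_sum_of_subset (Finset.range_mono hmn))
  · exact (ENNReal.tendsto_toReal (hfin (x, y))).comp (ENNReal.tendsto_nat_tsum _)

/-! ### Dyadic approximations -/

/-- `a n / 2 ^ n` is a nondecreasing dyadic approximation of `v`, which starts from `0`. -/
def DyadicApprox (a : ℕ → ℕ) (v : ℝ≥0∞) : Prop :=
  a 0 = 0 ∧ (∀ n, 2 * a n ≤ a (n + 1)) ∧ Tendsto (fun n => (a n : ℝ≥0∞) * 2⁻¹ ^ n) atTop (𝓝 v)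

theorem DyadicApprox.monotone {a : ℕ → ℕ} {v : ℝ≥0∞} (h : DyadicApprox a v) :
    Monotone fun n => (a n : ℝ≥0∞) * 2⁻¹ ^ n := by
  refine monotone_nat_of_le_succ fun n => ?_
  have h1 : (2 : ℝ≥0∞) * a n ≤ a (n + 1) := by exact_mod_cast h.2.1 n
  calc (a n : ℝ≥0∞) * 2⁻¹ ^ n = (2 * a n) * 2⁻¹ ^ (n + 1) := by
        rw [pow_succ, mul_comm (2 : ℝ≥0∞), mul_assoc, mul_comm (2⁻¹ ^ n : ℝ≥0∞), ← mul_assoc 2,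
          ENNReal.mul_inv_cancel (by norm_num) (by norm_num), one_mul]
    _ ≤ _ := by gcongr

theorem DyadicApprox.le {a : ℕ → ℕ} {v : ℝ≥0∞} (h : DyadicApprox a v) (n : ℕ) :
    (a n : ℝ≥0∞) * 2⁻¹ ^ n ≤ v :=
  h.monotone.ge_of_tendsto h.2.2 n

/-- At each stage both approximations have the same denominator `2 ^ n`, so the minimum is taken on
numerators. This is how `u` inherits a dyadic approximation from `m`. -/
theorem DyadicApprox.inf {a b : ℕ → ℕ} {v w : ℝ≥0∞} (ha : DyadicApprox a v)
    (hb : DyadicApprox b w) : DyadicApprox (fun n => min (a n) (b n)) (min v w) := by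
  refine ⟨by simp [ha.1], fun n => ?_, ?_⟩
  · have := ha.2.1 n
    have := hb.2.1 n
    simp only
    omega
  · refine (ha.2.2.min hb.2.2).congr fun n => ?_
    change _ = ((Min.min (a n) (b n) : ℕ) : ℝ≥0∞) * 2⁻¹ ^ n
    rcases le_total (a n) (b n) with h | h
    · rw [min_eq_left h, min_eq_left (by gcongr)]
    · rw [min_eq_right h, min_eq_right (by gcongr)]

/-- Lower semicomputable functions have computable dyadic approximations. -/
theorem LowerSemicomputable.exists_dyadicApprox {f : Str → Str → ℝ}
    (hf : LowerSemicomputable f) :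
    ∃ a : Str × Str → ℕ → ℕ, Computable₂ a ∧
      ∀ x y, DyadicApprox (a (x, y)) (ENNReal.ofReal (f x y)) := by
  obtain ⟨num, den, hnum, hden, h⟩ := hf
  -- The `n`-th rational is rounded down to a multiple of `2 ^ (-n)`, with error at most `2 ^ (-n)`.
  -- The factor `min n 1` only forces the value `0` at `n = 0`.
  refine ⟨fun p n => min n 1 * (2 ^ n * num (n, p) / (den (n, p) + 1)), ?_, ?_⟩
  · have hs : Computable fun p : (Str × Str) × ℕ => (p.2, p.1) :=
      Computable.pair Computable.snd Computable.fst
    exact Computable.nat_mul (Primrec.nat_min.to_comp.comp Computable.snd (Computable.const 1))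
      (Computable.nat_div (Computable.nat_mul (Computable.two_pow Computable.snd) (hnum.comp hs))
        (Computable.nat_add (hden.comp hs) (Computable.const 1)))
  · intro x y
    obtain ⟨hmono, htend⟩ := h x y
    set r : ℕ → ℝ := fun n => (num (n, x, y) : ℝ) / ((den (n, x, y) : ℝ) + 1) with hr
    have hr0 : ∀ n, 0 ≤ r n := fun n => by positivity
    have hfl : ∀ n, 2 ^ n * num (n, x, y) / (den (n, x, y) + 1) = ⌊2 ^ n * r n⌋₊ := by
      intro n
      have : (2 : ℝ) ^ n * r n =
          ((2 ^ n * num (n, x, y) : ℕ) : ℝ) / ((den (n, x, y) + 1 : ℕ) : ℝ) := by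
        simp only [hr]; push_cast; ring
      rw [this, Nat.floor_div_eq_div]
    simp only [hfl]
    refine ⟨by simp, fun n => ?_, ?_⟩
    · rcases Nat.eq_zero_or_pos n with rfl | hn
      · simp
      · have h1 : min n 1 = 1 := min_eq_right hn
        have h2 : min (n + 1) 1 = 1 := min_eq_right (by omega)
        simp only [h1, h2, one_mul]
        refine Nat.le_floor ?_
        push_cast
        calc 2 * (⌊2 ^ n * r n⌋₊ : ℝ) ≤ 2 * (2 ^ n * r n) := by
              gcongr; exact Nat.floor_le (by have := hr0 n; positivity)
          _ ≤ 2 * (2 ^ n * r (n + 1)) := by gcongr; exact hmono (Nat.le_succ n)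
          _ = _ := by ring
    · have key : Tendsto (fun n => (⌊2 ^ n * r n⌋₊ : ℝ) * 2⁻¹ ^ n) atTop (𝓝 (f x y)) := by
        have hlow : Tendsto (fun n => r n - (2⁻¹ : ℝ) ^ n) atTop (𝓝 (f x y)) := by
          simpa using htend.sub
            (tendsto_pow_atTop_nhds_zero_of_lt_one (r := (2⁻¹ : ℝ)) (by norm_num) (by norm_num))
        refine tendsto_of_tendsto_of_tendsto_of_le_of_le hlow htend (fun n => ?_) (fun n => ?_)
        · have h1 := (Nat.lt_floor_add_one (2 ^ n * r n)).le
          have h2 : (0 : ℝ) < 2⁻¹ ^ n := by positivity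
          have h3 : (2 : ℝ) ^ n * 2⁻¹ ^ n = 1 := by rw [← mul_pow]; norm_num
          have h4 := mul_le_mul_of_nonneg_right h1 h2.le
          have h5 : 2 ^ n * r n * 2⁻¹ ^ n = r n := by
            rw [mul_right_comm, h3, one_mul]
          simp only
          linarith
        · have h1 := Nat.floor_le (a := 2 ^ n * r n) (by have := hr0 n; positivity)
          have h2 : (0 : ℝ) < 2⁻¹ ^ n := by positivity
          have h3 : (2 : ℝ) ^ n * 2⁻¹ ^ n = 1 := by rw [← mul_pow]; norm_num
          have h4 := mul_le_mul_of_nonneg_right h1 h2.le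
          have h5 : 2 ^ n * r n * 2⁻¹ ^ n = r n := by
            rw [mul_right_comm, h3, one_mul]
          simp only
          linarith
      refine (ENNReal.tendsto_ofReal key).congr' ?_
      filter_upwards [eventually_ge_atTop 1] with n hn
      rw [min_eq_right hn, one_mul, ENNReal.ofReal_mul (by positivity), ENNReal.ofReal_natCast,
        ENNReal.ofReal_pow (by norm_num), ENNReal.ofReal_inv_of_pos (by norm_num)]
      simp

/-- The stream of increments of a dyadic approximation: the numbers `i = ⟨k, j⟩` with
`j < a k - 2 * a (k - 1)` carry the weight `2 ^ (-k)`. -/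
def incr (a : ℕ → ℕ) (i : ℕ) : Option ℕ :=
  if i.unpair.2 < a i.unpair.1 - 2 * a (i.unpair.1 - 1) then some i.unpair.1 else none

/-- An increment never appears before the level fine enough to represent it. The greedy allocation
relies on this: `2 ^ (n - k)` must not be a truncated exponent. -/
theorem le_of_incr_eq_some {a : ℕ → ℕ} {i k : ℕ} (h : incr a i = some k) : k ≤ i := by
  unfold incr at h
  split_ifs at h
  cases h
  exact Nat.unpair_left_le i

theorem computable_incr {α : Type*} [Primcodable α] {a : α → ℕ → ℕ} (ha : Computable₂ a) :
    Computable₂ fun x i => incr (a x) i := by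
  have h1 : Computable fun p : α × ℕ => p.2.unpair.1 := Computable.unpair_fst Computable.snd
  have h2 : Computable fun p : α × ℕ => p.2.unpair.2 := Computable.unpair_snd Computable.snd
  exact Computable.ite' (Computable.decide_lt h2 (Computable.nat_sub
    (ha.comp Computable.fst h1) (Computable.nat_mul (Computable.const 2)
      (ha.comp Computable.fst (Computable.nat_sub h1 (Computable.const 1))))))
    (Computable.option_some.comp h1) (Computable.const none)

theorem tsum_unpair (F : ℕ → ℕ → ℝ≥0∞) :
    ∑' i : ℕ, F i.unpair.1 i.unpair.2 = ∑' k, ∑' j, F k j := by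
  rw [← ENNReal.tsum_prod, ← Nat.pairEquiv.symm.tsum_eq fun p : ℕ × ℕ => F p.1 p.2]
  rfl

/-- With `decode₂` every element has exactly one index, so enumerating by numbers counts nothing
twice. -/
theorem tsum_decode₂ {β : Type*} [Encodable β] (F : β → ℝ≥0∞) :
    ∑' n : ℕ, (decode₂ β n).elim 0 F = ∑' b, F b := by
  rw [← (encode_injective (α := β)).tsum_eq]
  · simp
  · intro n hn
    rw [Function.mem_support] at hn
    cases h : decode₂ β n with
    | none => simp [h] at hn
    | some b => exact ⟨b, mem_decode₂.1 h⟩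

/-- Telescoping: level `k` contributes `a k / 2 ^ k - a (k - 1) / 2 ^ (k - 1)`, and the start `a 0 =
0` makes level `0` contribute nothing. -/
theorem DyadicApprox.tsum_incr {a : ℕ → ℕ} {v : ℝ≥0∞} (h : DyadicApprox a v) :
    ∑' i, wt (incr a i) = v := by
  have h1 : ∑' i, wt (incr a i) =
      ∑' k, ((a k - 2 * a (k - 1) : ℕ) : ℝ≥0∞) * 2⁻¹ ^ k := by
    have h2 : ∀ i, wt (incr a i) =
        if i.unpair.2 < a i.unpair.1 - 2 * a (i.unpair.1 - 1) then 2⁻¹ ^ i.unpair.1 else 0 :=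
      fun i => by unfold incr; split_ifs <;> rfl
    rw [tsum_congr h2,
      tsum_unpair fun k j => if j < a k - 2 * a (k - 1) then (2⁻¹ : ℝ≥0∞) ^ k else 0]
    refine tsum_congr fun k => ?_
    rw [tsum_eq_sum (s := Finset.range (a k - 2 * a (k - 1))) fun j hj => by simpa using hj]
    rw [Finset.sum_congr rfl fun j hj => if_pos (Finset.mem_range.1 hj)]
    simp
  rw [h1]
  refine tendsto_nhds_unique (ENNReal.tendsto_nat_tsum _) ((tendsto_add_atTop_iff_nat 1).1 ?_)
  refine h.2.2.congr fun n => ?_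
  induction n with
  | zero => simp [h.1]
  | succ n ih =>
    rw [Finset.sum_range_succ, ← ih, Nat.add_sub_cancel]
    have h2 := h.2.1 n
    obtain ⟨d, hd⟩ := Nat.exists_eq_add_of_le h2
    rw [hd, Nat.add_sub_cancel_left]
    push_cast
    rw [add_mul, pow_succ, mul_comm (2 : ℝ≥0∞) (a n : ℝ≥0∞), mul_assoc (a n : ℝ≥0∞) 2,
      ← mul_assoc 2, mul_comm (2 : ℝ≥0∞) (2⁻¹ ^ n), mul_assoc (2⁻¹ ^ n : ℝ≥0∞) 2,
      ENNReal.mul_inv_cancel (by norm_num) (by norm_num), mul_one]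

/-! ### Streams of requests -/

/-- For every condition `x`, a sequence of requests `(y, k)`; such a request adds `2 ^ (-k)` to
the mass of `y` given `x`. -/
abbrev Requests := Str → ℕ → Option (Str × ℕ)

/-- The size of a request if it is a request for `y`. -/
def sizeFor (y : Str) (o : Option (Str × ℕ)) : Option ℕ :=
  o.bind fun s => if s.1 = y then some s.2 else none

@[simp] theorem sizeFor_none (y : Str) : sizeFor y none = none := rfl

theorem sizeFor_some (y : Str) (s : Str × ℕ) :
    sizeFor y (some s) = if s.1 = y then some s.2 else none := rfl

/-- The mass of `y` given `x`. -/
noncomputable def mass (r : Requests) (x y : Str) : ℝ≥0∞ := ∑' n, wt (sizeFor y (r x n))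

/-- The total weight of all requests with condition `x`. -/
noncomputable def weight (r : Requests) (x : Str) : ℝ≥0∞ := ∑' n, wt ((r x n).map Prod.snd)

theorem tsum_wt_sizeFor (o : Option (Str × ℕ)) : ∑' y, wt (sizeFor y o) = wt (o.map Prod.snd) := by
  cases o with
  | none => simp
  | some s =>
    rw [tsum_eq_single s.1]
    · simp [sizeFor_some]
    · intro y hy
      simp [sizeFor_some, hy.symm]

theorem tsum_mass (r : Requests) (x : Str) : ∑' y, mass r x y = weight r x := by
  unfold mass weight
  rw [ENNReal.tsum_comm]
  exact tsum_congr fun n => tsum_wt_sizeFor _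

theorem mass_le_weight (r : Requests) (x y : Str) : mass r x y ≤ weight r x :=
  tsum_mass r x ▸ ENNReal.le_tsum y

theorem computable_sizeFor {α : Type*} [Primcodable α] {f : α → Str} {o : α → Option (Str × ℕ)}
    (hf : Computable f) (ho : Computable o) : Computable fun a => sizeFor (f a) (o a) := by
  refine Computable.option_bind ho (g := fun a s => if s.1 = f a then some s.2 else none) ?_
  exact Computable.ite'
    (Computable.decide_eq (Computable.fst.comp Computable.snd) (hf.comp Computable.fst))
    (Computable.option_some.comp (Computable.snd.comp Computable.snd)) (Computable.const none)

/-- The masses of a computable stream of requests form a semimeasure. -/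
theorem isCondSemimeasure_mass {r : Requests} (hr : Computable₂ r) (hw : ∀ x, weight r x ≤ 1) :
    IsCondSemimeasure fun y x => (mass r x y).toReal := by
  have hfin : ∀ x y, mass r x y ≠ ∞ := fun x y =>
    ne_top_of_le_ne_top ENNReal.one_ne_top ((mass_le_weight r x y).trans (hw x))
  refine ⟨?_, fun _ _ => ENNReal.toReal_nonneg, fun x => ⟨?_, ?_⟩⟩
  · exact lowerSemicomputable_tsum (q := fun p n => sizeFor p.1 (r p.2 n))
      (computable_sizeFor (Computable.fst.comp Computable.fst)
        (hr.comp (Computable.snd.comp Computable.fst) Computable.snd)) fun p => hfin p.2 p.1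
  · exact ENNReal.summable_toReal (ne_top_of_le_ne_top ENNReal.one_ne_top
      ((tsum_mass r x).trans_le (hw x)))
  · rw [← ENNReal.tsum_toReal_eq (hfin x), tsum_mass]
    exact ENNReal.toReal_le_of_le_ofReal zero_le_one (by simpa using hw x)

theorem IsCondSemimeasure.tsum_ofReal_le {f : Str → Str → ℝ} (hf : IsCondSemimeasure f) (x : Str) :
    ∑' y, ENNReal.ofReal (f y x) ≤ 1 := by
  rw [← ENNReal.ofReal_tsum_of_nonneg (fun y => hf.2.1 y x) (hf.2.2 x).1]
  simpa using (hf.2.2 x).2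

theorem IsCondSemimeasure.le_one {f : Str → Str → ℝ} (hf : IsCondSemimeasure f) (y x : Str) :
    f y x ≤ 1 := by
  simpa using (ENNReal.le_tsum y).trans (hf.tsum_ofReal_le x)

/-- The requests of all the streams `q (y, x)`, where `y` ranges over the strings. -/
def spread (q : Str × Str → ℕ → Option ℕ) : Requests := fun x i =>
  (decode₂ Str i.unpair.1).bind fun y => (q (y, x) i.unpair.2).map fun k => (y, k)

theorem computable_spread {q : Str × Str → ℕ → Option ℕ} (hq : Computable₂ q) :
    Computable₂ (spread q) := by
  refine Computable.option_bind (g := fun (p : Str × ℕ) y =>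
    (q (y, p.1) p.2.unpair.2).map fun k => (y, k)) ?_ ?_
  · exact Primrec.decode₂.to_comp.comp (Computable.unpair_fst Computable.snd)
  · refine Computable.option_map (g := fun (p : (Str × ℕ) × Str) k => (p.2, k)) ?_ ?_
    · exact hq.comp (Computable.pair Computable.snd (Computable.fst.comp Computable.fst))
        (Computable.unpair_snd (Computable.snd.comp Computable.fst))
    · exact Computable.pair (Computable.snd.comp Computable.fst) Computable.snd

theorem mass_spread (q : Str × Str → ℕ → Option ℕ) (x y : Str) :
    mass (spread q) x y = ∑' j, wt (q (y, x) j) := by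
  unfold mass spread
  have h : ∀ n, (∑' j, wt (sizeFor y ((decode₂ Str n).bind fun y' =>
      (q (y', x) j).map fun k => (y', k)))) =
      (decode₂ Str n).elim 0 fun y' => if y' = y then ∑' j, wt (q (y, x) j) else 0 := by
    intro n
    cases decode₂ Str n with
    | none => simp
    | some y' =>
      simp only [Option.bind_some, Option.elim]
      split_ifs with hy
      · subst hy
        refine tsum_congr fun j => ?_
        cases q (y', x) j <;> simp [sizeFor_some]
      · refine ENNReal.tsum_eq_zero.2 fun j => ?_
        cases q (y', x) j <;> simp [sizeFor_some, hy]
  rw [tsum_unpair fun n j => wt (sizeFor y ((decode₂ Str n).bind fun y' =>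
      (q (y', x) j).map fun k => (y', k))), tsum_congr h, tsum_decode₂, tsum_ite_eq]

/-- Every semimeasure is given by a computable stream of requests. -/
theorem IsCondSemimeasure.exists_requests {f : Str → Str → ℝ} (hf : IsCondSemimeasure f) :
    ∃ r : Requests, Computable₂ r ∧ (∀ x y, mass r x y = ENNReal.ofReal (f y x)) ∧
      ∀ x, weight r x ≤ 1 := by
  obtain ⟨a, ha, h⟩ := hf.1.exists_dyadicApprox
  have hm : ∀ x y, mass (spread fun p => incr (a p)) x y = ENNReal.ofReal (f y x) := fun x y => by
    rw [mass_spread, (h y x).tsum_incr]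
  refine ⟨spread fun p => incr (a p), computable_spread (computable_incr ha), hm, fun x => ?_⟩
  rw [← tsum_mass, tsum_congr (hm x)]
  exact hf.tsum_ofReal_le x

/-! ### The maximal semimeasure -/

/-- If the full partial sum is at most `1`, it bounds the trimmed one. Otherwise the last term has
been dropped, and induction applies. -/
theorem tsum_trim_le (w : ℕ → ℝ≥0∞) :
    ∑' i, (if ∑ j ∈ Finset.range (i + 1), w j ≤ 1 then w i else 0) ≤ 1 := by
  rw [ENNReal.tsum_eq_iSup_nat]
  refine iSup_le fun N => ?_
  suffices h : ∑ i ∈ Finset.range N, (if ∑ j ∈ Finset.range (i + 1), w j ≤ 1 then w i else 0) ≤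
      ∑ j ∈ Finset.range N, w j ∧
      ∑ i ∈ Finset.range N, (if ∑ j ∈ Finset.range (i + 1), w j ≤ 1 then w i else 0) ≤ 1 from h.2
  induction N with
  | zero => simp
  | succ N ih =>
    have h1 : ∑ i ∈ Finset.range (N + 1),
        (if ∑ j ∈ Finset.range (i + 1), w j ≤ 1 then w i else 0) ≤
        ∑ j ∈ Finset.range (N + 1), w j :=
      Finset.sum_le_sum fun i _ => by split_ifs <;> simp
    refine ⟨h1, ?_⟩
    by_cases h : ∑ j ∈ Finset.range (N + 1), w j ≤ 1
    · exact h1.trans h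
    · rw [Finset.sum_range_succ, if_neg h, add_zero]
      exact ih.2

/-- The requests of a stream up to the moment when the total weight exceeds `1`. -/
def trim (q : ℕ → Option (Str × ℕ)) (i : ℕ) : Option (Str × ℕ) :=
  if (acc (fun j => (q j).map Prod.snd) (i + 1)).1 ≤ (acc (fun j => (q j).map Prod.snd) (i + 1)).2
  then q i else none

theorem computable_trim {α : Type*} [Primcodable α] {q : α → ℕ → Option (Str × ℕ)}
    (hq : Computable₂ q) : Computable₂ fun a i => trim (q a) i := by
  have h1 : Computable₂ fun a j => (q a j).map Prod.snd :=
    Computable.option_map hq (Computable.snd.comp Computable.snd)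
  have h2 : Computable fun p : α × ℕ => acc (fun j => (q p.1 j).map Prod.snd) (p.2 + 1) :=
    (computable_acc h1).comp Computable.fst (Computable.succ.comp Computable.snd)
  exact Computable.ite' (Computable.decide_le (Computable.fst.comp h2) (Computable.snd.comp h2))
    hq (Computable.const none)

theorem tsum_trim (q : ℕ → Option (Str × ℕ)) : ∑' i, wt ((trim q i).map Prod.snd) ≤ 1 := by
  refine le_of_eq_of_le (tsum_congr fun i => ?_) (tsum_trim_le fun j => wt ((q j).map Prod.snd))
  unfold trim
  simp only [acc_fst_le_snd_iff]
  split_ifs <;> rfl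

theorem trim_eq_self {q : ℕ → Option (Str × ℕ)} (hq : ∑' i, wt ((q i).map Prod.snd) ≤ 1) (i : ℕ) :
    trim q i = q i := by
  unfold trim
  rw [if_pos]
  rw [acc_fst_le_snd_iff]
  exact (ENNReal.sum_le_tsum _).trans hq

/-- Shape of `exists_evaluation`: summing over evaluation steps recovers the value with multiplicity
one. -/
theorem tsum_option_eq {σ : Type*} {g : ℕ → Option σ} {s : σ} (φ : Option σ → ℝ≥0∞)
    (hφ : φ none = 0) (h : ∃ t, g t = some s ∧ ∀ t' ≠ t, g t' = none) :
    ∑' t, φ (g t) = φ (some s) := by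
  obtain ⟨t, ht, h⟩ := h
  rw [tsum_eq_single t, ht]
  intro t' ht'
  rw [h t' ht', hφ]

/-- There is a uniformly computable family of streams that contains, up to the order of the
requests, all computable streams. -/
theorem exists_universal_family :
    ∃ q : ℕ × Str → ℕ → Option (Str × ℕ), Computable₂ q ∧
      ∀ r : Requests, Computable₂ r → ∃ c, ∀ x, ∀ φ : Option (Str × ℕ) → ℝ≥0∞, φ none = 0 →
        ∑' i, φ (q (c, x) i) = ∑' n, φ (r x n) := by
  let F : (ℕ × Str) × ℕ →. Option (Str × ℕ) := fun p =>
    (Nat.Partrec.Code.eval (ofNat Nat.Partrec.Code p.1.1) (encode (p.1.2, p.2))).map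
      fun v => (decode (α := Option (Str × ℕ)) v).bind id
  have hF : Partrec F := by
    refine Partrec.map (Nat.Partrec.Code.eval_part.comp
      ((Computable.ofNat _).comp (Computable.fst.comp Computable.fst))
      (Computable.encode.comp (Computable.pair (Computable.snd.comp Computable.fst)
        Computable.snd))) ?_
    exact Computable.option_bind (Computable.decode.comp Computable.snd) Computable.snd
  obtain ⟨g, hg, hgF⟩ := exists_evaluation hF
  -- The index `i` codes a pair (request number, evaluation step), which makes the stream total even
  -- when the code diverges. The dovetailing reorders requests, hence the comparison only through
  -- sums of an arbitrary `φ`.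
  refine ⟨fun p i => (g (p, i.unpair.1) i.unpair.2).bind id, ?_, ?_⟩
  · refine Computable.option_bind (f := fun p : (ℕ × Str) × ℕ =>
      g (p.1, p.2.unpair.1) p.2.unpair.2) ?_ Computable.snd
    exact hg.comp (Computable.pair Computable.fst (Computable.unpair_fst Computable.snd))
      (Computable.unpair_snd Computable.snd)
  · intro r hr
    obtain ⟨c, hc⟩ := Nat.Partrec.Code.exists_code.1 (show Partrec fun p : Str × ℕ =>
      (Part.some (r p.1 p.2)) from hr)
    refine ⟨encode c, fun x φ hφ => ?_⟩
    rw [tsum_unpair fun n t => φ ((g ((encode c, x), n) t).bind id)]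
    refine tsum_congr fun n => ?_
    have hm : r x n ∈ F ((encode c, x), n) := by
      simp only [F, ofNat_encode, hc]
      simp
    exact tsum_option_eq (fun o => φ (o.bind id)) hφ ((hgF _).1 _ hm)

/-- A universal stream of requests. -/
theorem exists_universal_requests :
    ∃ r : Requests, Computable₂ r ∧ (∀ x, weight r x ≤ 1) ∧
      ∀ r' : Requests, Computable₂ r' → (∀ x, weight r' x ≤ 1) →
        ∃ c : ℕ, ∀ x y, mass r' x y ≤ 2 ^ c * mass r x y := by
  obtain ⟨q, hq, hu⟩ := exists_universal_family
  -- Stream number `c`, trimmed, is slowed down by `c + 1` extra units of size, that is, multiplied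
  -- by `2 ^ (-(c + 1))`; these factors sum to `1`.
  let R : Requests := fun x i =>
    (trim (q (i.unpair.1, x)) i.unpair.2).map fun s => (s.1, s.2 + (i.unpair.1 + 1))
  have hmass : ∀ x y, mass R x y =
      ∑' c : ℕ, 2⁻¹ ^ (c + 1) * ∑' j, wt (sizeFor y (trim (q (c, x)) j)) := by
    intro x y
    unfold mass
    simp only [R]
    rw [tsum_unpair fun c j => wt (sizeFor y ((trim (q (c, x)) j).map
      fun s => (s.1, s.2 + (c + 1))))]
    refine tsum_congr fun c => ?_
    rw [← ENNReal.tsum_mul_left]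
    refine tsum_congr fun j => ?_
    cases trim (q (c, x)) j with
    | none => simp
    | some s =>
      simp only [Option.map_some, sizeFor_some]
      split_ifs
      · simp [pow_add, mul_comm]
      · simp
  refine ⟨R, ?_, fun x => ?_, fun r' hr' hw => ?_⟩
  · refine Computable.option_map (f := fun p : Str × ℕ =>
      trim (q (p.2.unpair.1, p.1)) p.2.unpair.2)
      (g := fun (p : Str × ℕ) (s : Str × ℕ) => (s.1, s.2 + (p.2.unpair.1 + 1))) ?_ ?_
    · exact (computable_trim hq).comp (Computable.pair (Computable.unpair_fst Computable.snd)
        Computable.fst) (Computable.unpair_snd Computable.snd)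
    · exact Computable.pair (Computable.fst.comp Computable.snd)
        (Computable.nat_add (Computable.snd.comp Computable.snd)
          (Computable.succ.comp (Computable.unpair_fst (Computable.snd.comp Computable.fst))))
  · rw [← tsum_mass, tsum_congr (hmass x), ENNReal.tsum_comm]
    calc ∑' c : ℕ, ∑' y, 2⁻¹ ^ (c + 1) * ∑' j, wt (sizeFor y (trim (q (c, x)) j))
        ≤ ∑' c : ℕ, (2⁻¹ : ℝ≥0∞) ^ (c + 1) := by
          refine ENNReal.tsum_le_tsum fun c => ?_
          rw [ENNReal.tsum_mul_left, ENNReal.tsum_comm, tsum_congr fun j => tsum_wt_sizeFor _]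
          exact mul_le_of_le_one_right' (tsum_trim _)
      _ = 1 := tsum_geometric_succ
  · obtain ⟨c, hc⟩ := hu r' hr'
    refine ⟨c + 1, fun x y => ?_⟩
    -- A stream of total weight at most `1` is untouched by trimming, so `R` contains it with factor
    -- `2 ^ (-(c + 1))`.
    have h1 : ∀ j, trim (q (c, x)) j = q (c, x) j :=
      trim_eq_self ((hc x (fun o => wt (o.map Prod.snd)) rfl).trans_le (hw x))
    have h2 : mass r' x y = ∑' j, wt (sizeFor y (trim (q (c, x)) j)) := by
      simp only [h1]
      exact (hc x (fun o => wt (sizeFor y o)) rfl).symm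
    calc mass r' x y = 2 ^ (c + 1) * (2⁻¹ ^ (c + 1) * mass r' x y) := by
          rw [← mul_assoc, two_pow_mul_inv, one_mul]
      _ ≤ 2 ^ (c + 1) * mass R x y := by
          gcongr
          rw [hmass, h2]
          exact ENNReal.le_tsum (f := fun c : ℕ =>
            (2⁻¹ : ℝ≥0∞) ^ (c + 1) * ∑' j, wt (sizeFor y (trim (q (c, x)) j))) c

theorem exists_isMaximalCondSemimeasure : ∃ m, IsMaximalCondSemimeasure m := by
  obtain ⟨r, hr, hw, hu⟩ := exists_universal_requests
  refine ⟨_, isCondSemimeasure_mass hr hw, fun m' hm' => ?_⟩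
  obtain ⟨r', hr', hmass, hw'⟩ := hm'.exists_requests
  obtain ⟨c, hc⟩ := hu r' hr' hw'
  refine ⟨2 ^ c, by positivity, fun y x => ?_⟩
  have hfin : mass r x y ≠ ∞ :=
    ne_top_of_le_ne_top ENNReal.one_ne_top ((mass_le_weight r x y).trans (hw x))
  have h := ENNReal.toReal_mono (ENNReal.mul_ne_top (by simp) hfin) (hc x y)
  rwa [hmass, ENNReal.toReal_ofReal (hm'.2.1 y x), ENNReal.toReal_mul, ENNReal.toReal_pow,
    ENNReal.toReal_ofNat] at h

/-- Maximal semimeasures are positive. -/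
theorem IsMaximalCondSemimeasure.pos {m : Str → Str → ℝ} (hm : IsMaximalCondSemimeasure m)
    (y x : Str) : 0 < m y x := by
  -- Comparison semimeasure that gives `y` the positive weight `2 ^ (-(encode y + 1))` under every
  -- condition.
  let r : Requests := fun _ n => (decode₂ Str n).map fun y => (y, n + 1)
  have hr : Computable₂ r :=
    Computable.option_map (Primrec.decode₂.to_comp.comp Computable.snd)
      (g := fun (p : Str × ℕ) (y : Str) => (y, p.2 + 1))
      (Computable.pair Computable.snd (Computable.succ.comp (Computable.snd.comp Computable.fst)))
  have hw : ∀ x, weight r x ≤ 1 := fun x => by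
    rw [← tsum_geometric_succ]
    refine ENNReal.tsum_le_tsum fun n => ?_
    simp only [r]
    cases decode₂ Str n <;> simp
  obtain ⟨c, hc, h⟩ := hm.2 _ (isCondSemimeasure_mass hr hw)
  have hpos : 0 < (mass r x y).toReal := by
    refine ENNReal.toReal_pos ?_
      (ne_top_of_le_ne_top ENNReal.one_ne_top ((mass_le_weight r x y).trans (hw x)))
    intro h0
    have := ENNReal.tsum_eq_zero.1 h0 (encode y)
    simp [r, sizeFor_some] at this
  exact pos_of_mul_pos_right (hpos.trans_le (h y x)) hc.le

/-! ### Intervals of the Cantor space -/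

instance : IsProbabilityMeasure coinMeasure := by unfold coinMeasure; infer_instance

theorem interval_eq_pi (p : Str) :
    interval p = Set.pi (Finset.range p.length : Set ℕ) fun i => {p.getD i false} := by
  ext π
  simp only [interval, Set.mem_ofPred_eq, Set.mem_pi, Finset.coe_range, Set.mem_Iio,
    Set.mem_singleton_iff]
  constructor
  · intro h i hi
    rw [h ⟨i, hi⟩]
    simp [hi]
  · intro h i
    rw [h i i.2]
    simp

theorem measurableSet_interval (p : Str) : MeasurableSet (interval p) := by
  rw [interval_eq_pi]
  exact MeasurableSet.pi (Finset.countable_toSet _) fun _ _ => MeasurableSet.singleton _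

theorem coinMeasure_interval (p : Str) : coinMeasure (interval p) = 2⁻¹ ^ p.length := by
  rw [interval_eq_pi, coinMeasure, Measure.infinitePi_pi _ fun _ _ => MeasurableSet.singleton _]
  simp

theorem prefix_of_mem_interval {π : Cantor} {p p' : Str} (hp : π ∈ interval p)
    (hp' : π ∈ interval p') (h : p.length ≤ p'.length) : p <+: p' := by
  rw [List.prefix_iff_eq_take]
  refine List.ext_getElem (by simp [h]) fun i h1 h2 => ?_
  have e1 := hp ⟨i, h1⟩
  have e2 := hp' ⟨i, by omega⟩
  simp only [List.get_eq_getElem] at e1 e2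
  rw [List.getElem_take, ← e1, ← e2]

/-! ### Probabilities of the events of a machine -/

theorem PrefixFree.eq_of_mem_interval {U : Machine} (hU : PrefixFree U) {x : Str} {p p' : Str}
    {π : Cantor} (hp : (U p x).Dom) (hp' : (U p' x).Dom) (h : π ∈ interval p)
    (h' : π ∈ interval p') : p = p' := by
  rcases le_total p.length p'.length with hl | hl
  · exact hU x p p' (prefix_of_mem_interval h h' hl) hp hp'
  · exact (hU x p' p (prefix_of_mem_interval h' h hl) hp' hp).symm

theorem mapsEvent_eq_iUnion (U : Machine) (x y : Str) :
    mapsEvent U x y = ⋃ p : Str, {π | π ∈ interval p ∧ y ∈ U p x} := by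
  ext π
  simp [mapsEvent]

theorem measurableSet_mapsEvent (U : Machine) (x y : Str) : MeasurableSet (mapsEvent U x y) := by
  rw [mapsEvent_eq_iUnion]
  exact MeasurableSet.iUnion fun p => (measurableSet_interval p).inter (MeasurableSet.const _)

open Classical in
-- Prefix-freeness makes the intervals of the halting programs disjoint, so their measures add up.
theorem coinMeasure_mapsEvent {U : Machine} (hU : PrefixFree U) (x y : Str) :
    coinMeasure (mapsEvent U x y) = ∑' p : Str, if y ∈ U p x then 2⁻¹ ^ p.length else 0 := by
  rw [mapsEvent_eq_iUnion, measure_iUnion]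
  · refine tsum_congr fun p => ?_
    split_ifs with h
    · simp [h, coinMeasure_interval]
    · simp [h]
  · intro p p' hne
    rw [Function.onFun, Set.disjoint_left]
    rintro π ⟨h1, h2⟩ ⟨h3, h4⟩
    exact hne (hU.eq_of_mem_interval (Part.dom_iff_mem.2 ⟨y, h2⟩)
      (Part.dom_iff_mem.2 ⟨y, h4⟩) h1 h3)
  · exact fun p => (measurableSet_interval p).inter (MeasurableSet.const _)

theorem disjoint_mapsEvent {U : Machine} (hU : PrefixFree U) (x : Str) {y z : Str} (h : y ≠ z) :
    Disjoint (mapsEvent U x y) (mapsEvent U x z) := by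
  rw [Set.disjoint_left]
  rintro π ⟨p, h1, h2⟩ ⟨p', h3, h4⟩
  have := hU.eq_of_mem_interval (Part.dom_iff_mem.2 ⟨y, h2⟩) (Part.dom_iff_mem.2 ⟨z, h4⟩) h1 h3
  subst this
  exact h (Part.mem_unique h2 h4)

/-- The output probabilities of a prefix-free machine form a semimeasure. -/
theorem IsPrefixFreeMachine.isCondSemimeasure {U : Machine} (hU : IsPrefixFreeMachine U) :
    IsCondSemimeasure fun y x => coinMeasure.real (mapsEvent U x y) := by
  classical
  obtain ⟨g, hg, hgU⟩ := exists_evaluation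
    (f := fun q : Str × Str => U q.1 q.2) hU.1
  let r : Requests := fun x i => (decode₂ Str i.unpair.1).bind fun p =>
    (g (p, x) i.unpair.2).map fun y => (y, p.length)
  have hr : Computable₂ r := by
    refine Computable.option_bind (g := fun (q : Str × ℕ) p =>
      (g (p, q.1) q.2.unpair.2).map fun y => (y, p.length)) ?_ ?_
    · exact Primrec.decode₂.to_comp.comp (Computable.unpair_fst Computable.snd)
    · refine Computable.option_map (g := fun (q : (Str × ℕ) × Str) y => (y, q.2.length)) ?_ ?_
      · exact hg.comp (Computable.pair Computable.snd (Computable.fst.comp Computable.fst))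
          (Computable.unpair_snd (Computable.snd.comp Computable.fst))
      · exact Computable.pair Computable.snd
          (Computable.list_length.comp (Computable.snd.comp Computable.fst))
  have hm : ∀ x y, mass r x y = coinMeasure (mapsEvent U x y) := by
    intro x y
    rw [coinMeasure_mapsEvent hU.2]
    unfold mass
    simp only [r]
    rw [tsum_unpair fun n t => wt (sizeFor y ((decode₂ Str n).bind fun p =>
      (g (p, x) t).map fun y => (y, p.length))),
      ← tsum_decode₂ fun p : Str => if y ∈ U p x then (2⁻¹ : ℝ≥0∞) ^ p.length else 0]
    refine tsum_congr fun n => ?_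
    cases decode₂ Str n with
    | none => simp
    | some p =>
      simp only [Option.bind_some, Option.elim]
      by_cases hd : (U p x).Dom
      · obtain ⟨s, hs⟩ := Part.dom_iff_mem.1 hd
        rw [tsum_option_eq (fun o => wt (sizeFor y (o.map fun y => (y, p.length)))) rfl
          ((hgU (p, x)).1 s hs)]
        simp only [Option.map_some, sizeFor_some]
        have : y ∈ U p x ↔ s = y := ⟨fun h => Part.mem_unique hs h, fun h => h ▸ hs⟩
        simp only [this]
        split_ifs <;> rfl
      · have h1 : ∀ s, s ∉ U p x := fun s hs => hd (Part.dom_iff_mem.2 ⟨s, hs⟩)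
        simp [(hgU (p, x)).2 h1, h1]
  -- The total weight is at most `1` because the events for different outputs are disjoint in a
  -- probability space.
  have := isCondSemimeasure_mass hr fun x => by
    rw [← tsum_mass, tsum_congr (hm x), ← measure_iUnion
      (fun y z h => disjoint_mapsEvent hU.2 x h) fun y => measurableSet_mapsEvent U x y]
    exact prob_le_one
  simp only [hm] at this
  exact this

theorem pow_length_le_coinMeasure {U : Machine} {p x y : Str} (h : y ∈ U p x) :
    (2⁻¹ : ℝ) ^ p.length ≤ coinMeasure.real (mapsEvent U x y) := by
  have h1 : interval p ⊆ mapsEvent U x y := fun π hπ => ⟨p, hπ, h⟩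
  have h2 := measureReal_mono (μ := coinMeasure) h1
  have h3 : coinMeasure.real (interval p) = (2⁻¹ : ℝ) ^ p.length := by
    simp [Measure.real, coinMeasure_interval]
  rwa [h3] at h2

theorem backForthProb_comm (U : Machine) (x y : Str) :
    backForthProb U x y = backForthProb U y x := by
  unfold backForthProb backForthEvent
  rw [Set.inter_comm]

theorem backForthProb_le (U : Machine) (x y : Str) :
    backForthProb U x y ≤ coinMeasure.real (mapsEvent U x y) :=
  measureReal_mono Set.inter_subset_left

/-! ### Strings as binary numbers -/

/-- The number that a string denotes in binary. -/
def binVal (p : Str) : ℕ := p.foldl (fun a b => 2 * a + b.toNat) 0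

theorem computable_binVal : Computable binVal := by
  have : Primrec binVal := by
    refine Primrec.list_foldl (h := fun (_ : Str) (s : ℕ × Bool) => 2 * s.1 + s.2.toNat)
      Primrec.id (Primrec.const 0) ?_
    exact Primrec.nat_add.comp (Primrec.nat_mul.comp (Primrec.const 2)
      (Primrec.fst.comp Primrec.snd)) ((Primrec.dom_bool Bool.toNat).comp
        (Primrec.snd.comp Primrec.snd))
  exact this.to_comp

theorem binVal_concat (p : Str) (b : Bool) : binVal (p ++ [b]) = 2 * binVal p + b.toNat := by
  simp [binVal]

theorem binVal_append (p q : Str) : binVal (p ++ q) = binVal p * 2 ^ q.length + binVal q := by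
  induction q using List.reverseRecOn with
  | nil => simp [binVal]
  | append_singleton q b ih =>
    rw [← List.append_assoc, binVal_concat, ih, binVal_concat, List.length_append]
    simp only [List.length_singleton, pow_succ]
    ring

theorem binVal_lt (p : Str) : binVal p < 2 ^ p.length := by
  induction p using List.reverseRecOn with
  | nil => simp [binVal]
  | append_singleton q b ih =>
    rw [binVal_concat, List.length_append, List.length_singleton, pow_succ]
    have := b.toNat_le
    omega

theorem binVal_injective {p q : Str} (hl : p.length = q.length) (h : binVal p = binVal q) :
    p = q := by
  induction p using List.reverseRecOn generalizing q with
  | nil => exact (List.length_eq_zero_iff.1 hl.symm).symm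
  | append_singleton p b ih =>
    rcases List.eq_nil_or_concat q with rfl | ⟨q, c, rfl⟩
    · simp at hl
    · rw [List.concat_eq_append] at *
      rw [binVal_concat, binVal_concat] at h
      have h1 := b.toNat_le
      have h2 := c.toNat_le
      have h3 : binVal p = binVal q := by omega
      have h4 : b.toNat = c.toNat := by omega
      rw [ih (by simpa using hl) h3]
      congr 2
      revert h4
      cases b <;> cases c <;> simp

theorem exists_binVal_eq (L k : ℕ) (hk : k < 2 ^ L) : ∃ p : Str, p.length = L ∧ binVal p = k := by
  induction L generalizing k with
  | zero => exact ⟨[], rfl, by simp [binVal] at *; omega⟩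
  | succ L ih =>
    obtain ⟨p, hp, hv⟩ := ih (k / 2) (by rw [pow_succ] at hk; omega)
    refine ⟨p ++ [decide (k % 2 = 1)], by simp [hp], ?_⟩
    rw [binVal_concat, hv]
    rcases Nat.mod_two_eq_zero_or_one k with h | h <;> simp [h] <;> omega

/-- Dividing by a power of two deletes trailing bits. This matches the arithmetic test in `Blocked`
with the prefix relation. -/
theorem binVal_div_of_prefix {p p' : Str} (h : p <+: p') :
    binVal p' / 2 ^ (p'.length - p.length) = binVal p := by
  obtain ⟨q, rfl⟩ := h
  rw [binVal_append, List.length_append, Nat.add_sub_cancel_left, mul_comm,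
    Nat.mul_add_div (by positivity), Nat.div_eq_of_lt (binVal_lt q), add_zero]

/-- The left end of the interval of reals that corresponds to a string. -/
noncomputable def leftEnd (p : Str) : ℝ := binVal p * 2⁻¹ ^ p.length

theorem leftEnd_le_of_prefix {p p' : Str} (h : p <+: p') : leftEnd p ≤ leftEnd p' := by
  obtain ⟨q, rfl⟩ := h
  unfold leftEnd
  rw [binVal_append, List.length_append, pow_add]
  push_cast
  have : (2 : ℝ) ^ q.length * 2⁻¹ ^ q.length = 1 := by rw [← mul_pow]; norm_num
  have h2 : (binVal p * 2 ^ q.length + binVal q : ℝ) * (2⁻¹ ^ p.length * 2⁻¹ ^ q.length) =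
      binVal p * 2⁻¹ ^ p.length * (2 ^ q.length * 2⁻¹ ^ q.length) +
        binVal q * (2⁻¹ ^ p.length * 2⁻¹ ^ q.length) := by ring
  rw [h2, this, mul_one]
  have : (0 : ℝ) ≤ binVal q * (2⁻¹ ^ p.length * 2⁻¹ ^ q.length) := by positivity
  linarith

theorem leftEnd_append_lt (p q : Str) : leftEnd (p ++ q) < leftEnd p + 2⁻¹ ^ p.length := by
  unfold leftEnd
  rw [binVal_append, List.length_append, pow_add]
  have h0 : (binVal q : ℝ) < 2 ^ q.length := by exact_mod_cast binVal_lt q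
  push_cast
  have h1 : (2 : ℝ) ^ q.length * 2⁻¹ ^ q.length = 1 := by rw [← mul_pow]; norm_num
  have h2 : (binVal p * 2 ^ q.length + binVal q : ℝ) * (2⁻¹ ^ p.length * 2⁻¹ ^ q.length) =
      binVal p * 2⁻¹ ^ p.length * (2 ^ q.length * 2⁻¹ ^ q.length) +
        (binVal q * 2⁻¹ ^ q.length) * 2⁻¹ ^ p.length := by ring
  rw [h2, h1, mul_one]
  have h3 : (binVal q : ℝ) * 2⁻¹ ^ q.length < 1 := by
    rw [← h1]; gcongr
  have h4 : (0 : ℝ) < 2⁻¹ ^ p.length := by positivity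
  have := mul_lt_mul_of_pos_right h3 h4
  linarith

/-! ### The machine that serves a stream of requests -/

/-- The total weight of the requests before the `n`-th one. -/
noncomputable def weightBefore (r : Requests) (x : Str) (n : ℕ) : ℝ :=
  (∑ i ∈ Finset.range n, wt ((r x i).map Prod.snd)).toReal

theorem weightBefore_mono (r : Requests) (x : Str) : Monotone (weightBefore r x) := by
  intro m n hmn
  refine ENNReal.toReal_mono (ENNReal.sum_ne_top.2 fun i _ => wt_ne_top _) ?_
  exact Finset.sum_le_sum_of_subset (Finset.range_mono hmn)

theorem weightBefore_nonneg (r : Requests) (x : Str) (n : ℕ) : 0 ≤ weightBefore r x n :=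
  ENNReal.toReal_nonneg

theorem weightBefore_succ {r : Requests} {x y : Str} {n k : ℕ} (h : r x n = some (y, k)) :
    weightBefore r x (n + 1) = weightBefore r x n + 2⁻¹ ^ k := by
  unfold weightBefore
  rw [Finset.sum_range_succ, ENNReal.toReal_add (ENNReal.sum_ne_top.2 fun i _ => wt_ne_top _)
    (wt_ne_top _), h]
  simp

theorem weightBefore_le_one {r : Requests} {x : Str} (h : weight r x ≤ 1) (n : ℕ) :
    weightBefore r x n ≤ 1 :=
  ENNReal.toReal_le_of_le_ofReal zero_le_one (by simpa using (ENNReal.sum_le_tsum _).trans h)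

/-- The string `p` serves a request of size `k` for which the interval of length `2 ^ (-k)` from
`s` is reserved. -/
def Serves (s : ℝ) (k : ℕ) (p : Str) : Prop :=
  p.length = k + 1 ∧ s ≤ leftEnd p ∧ leftEnd p < s + 2⁻¹ ^ (k + 1)

/-- Clears denominators: for a rational left end, serving is a decidable condition on natural
numbers. -/
theorem serves_iff {a b k : ℕ} (hb : 0 < b) (p : Str) :
    Serves ((a : ℝ) / b) k p ↔
      p.length = k + 1 ∧ a * 2 ^ (k + 1) ≤ binVal p * b ∧ binVal p * b < a * 2 ^ (k + 1) + b := by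
  refine and_congr_right fun hl => ?_
  unfold leftEnd
  rw [hl]
  have hb' : (0 : ℝ) < b := by exact_mod_cast hb
  have h2 : (0 : ℝ) < 2 ^ (k + 1) := by positivity
  refine and_congr ?_ ?_
  · rw [inv_pow, ← div_eq_mul_inv, div_le_div_iff₀ hb' h2]
    exact_mod_cast Iff.rfl
  · have : (a : ℝ) / b + 2⁻¹ ^ (k + 1) = (a * 2 ^ (k + 1) + b) / (b * 2 ^ (k + 1)) := by
      rw [inv_pow]; field_simp
    rw [this, inv_pow, ← div_eq_mul_inv, div_lt_div_iff₀ h2 (by positivity), ← mul_assoc,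
      mul_lt_mul_iff_left₀ h2]
    exact_mod_cast Iff.rfl

/-- Rounding `s` up to a multiple of `2 ^ (-(k + 1))` loses less than half of the reserved length `2
^ (-k)`, so an aligned interval of half the length still fits. This costs the one extra bit of the
program. -/
theorem exists_serves {s : ℝ} {k : ℕ} (h0 : 0 ≤ s) (h1 : s + 2⁻¹ ^ k ≤ 1) :
    ∃ p, Serves s k p := by
  have h2 : (0 : ℝ) < 2 ^ (k + 1) := by positivity
  have h3 : (2 : ℝ) ^ (k + 1) * 2⁻¹ ^ (k + 1) = 1 := by rw [← mul_pow]; norm_num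
  have hc := Nat.ceil_lt_add_one (a := s * 2 ^ (k + 1)) (by positivity)
  have h5 : s * 2 ^ (k + 1) + 2 ≤ 2 ^ (k + 1) := by
    have h6 : (2⁻¹ : ℝ) ^ k * 2 ^ (k + 1) = 2 := by
      rw [pow_succ, ← mul_assoc, ← mul_pow]; norm_num
    have := mul_le_mul_of_nonneg_right h1 h2.le
    rw [add_mul, h6] at this
    linarith
  obtain ⟨p, hp, hv⟩ := exists_binVal_eq (k + 1) ⌈s * 2 ^ (k + 1)⌉₊ (by
    rw [← Nat.cast_lt (α := ℝ)]; push_cast; linarith)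
  refine ⟨p, hp, ?_, ?_⟩
  · unfold leftEnd
    rw [hp, hv, inv_pow, ← div_eq_mul_inv, le_div_iff₀ h2]
    exact Nat.le_ceil _
  · unfold leftEnd
    rw [hp, hv, inv_pow, ← div_eq_mul_inv, div_lt_iff₀ h2, add_mul, inv_mul_cancel₀ h2.ne']
    exact hc

theorem Serves.lt {s : ℝ} {k : ℕ} {p p' : Str} (h : Serves s k p)
    (hle : leftEnd p' ≤ leftEnd p) : leftEnd p' < s + 2⁻¹ ^ k := by
  have h1 : (0 : ℝ) < 2⁻¹ ^ (k + 1) := by positivity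
  have h2 := h.2.2
  have h3 : (2⁻¹ : ℝ) ^ k = 2 * 2⁻¹ ^ (k + 1) := by rw [pow_succ]; ring
  linarith

theorem leftEnd_add_le_of_lt {p p' : Str} (hl : p.length = p'.length)
    (h : leftEnd p < leftEnd p') : leftEnd p + 2⁻¹ ^ p.length ≤ leftEnd p' := by
  unfold leftEnd at *
  rw [← hl] at *
  have h1 : (0 : ℝ) < 2⁻¹ ^ p.length := by positivity
  have h2 : (binVal p : ℝ) < binVal p' := lt_of_mul_lt_mul_right h h1.le
  have h3 : (binVal p : ℝ) + 1 ≤ binVal p' := by exact_mod_cast h2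
  nlinarith

/-- The window for the left end is half-open and exactly one grid step long, so it holds at most one
grid point. -/
theorem Serves.unique {s : ℝ} {k : ℕ} {p p' : Str} (h : Serves s k p) (h' : Serves s k p') :
    p = p' := by
  have hl : p.length = p'.length := h.1.trans h'.1.symm
  have heq : leftEnd p = leftEnd p' := by
    obtain ⟨h1, h2, h3⟩ := h
    obtain ⟨h1', h2', h3'⟩ := h'
    by_contra hne
    rcases lt_or_gt_of_ne hne with hlt | hlt
    · have := leftEnd_add_le_of_lt hl hlt
      rw [h1] at this
      linarith
    · have := leftEnd_add_le_of_lt hl.symm hlt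
      rw [h1'] at this
      linarith
  refine binVal_injective hl ?_
  unfold leftEnd at heq
  rw [hl] at heq
  exact_mod_cast mul_right_cancel₀ (by positivity) heq

/-- Strings that serve different requests are not comparable. -/
theorem index_eq_of_serves {r : Requests} {x y y' p p' : Str} {n n' k k' : ℕ} (hp : p <+: p')
    (h : r x n = some (y, k)) (hs : Serves (weightBefore r x n) k p)
    (h' : r x n' = some (y', k')) (hs' : Serves (weightBefore r x n') k' p') : n = n' := by
  by_contra hne
  have hle := leftEnd_le_of_prefix hp
  -- The reserved intervals are laid side by side in the order of the requests, and the interval of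
  -- a serving string stays inside its own. The interval of `p'` lies inside that of `p`, so the two
  -- requests cannot have separate reserved intervals.
  rcases lt_or_gt_of_ne hne with hlt | hlt
  · have h1 := weightBefore_mono r x (Nat.succ_le_of_lt hlt)
    rw [Nat.succ_eq_add_one, weightBefore_succ h] at h1
    have hk := hs.2.2
    have h2 := hs'.2.1
    obtain ⟨q, rfl⟩ := hp
    have h3 : leftEnd (p ++ q) < leftEnd p + 2⁻¹ ^ p.length := leftEnd_append_lt p q
    have h4 : (2⁻¹ : ℝ) ^ k = 2⁻¹ ^ p.length + 2⁻¹ ^ (k + 1) := by rw [hs.1, pow_succ]; ring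
    linarith
  · have h1 := weightBefore_mono r x (Nat.succ_le_of_lt hlt)
    rw [Nat.succ_eq_add_one, weightBefore_succ h'] at h1
    have h2 := hs.2.1
    have h3 := hs'.lt hle
    linarith

/-- If the requests have total weight at most `1`, there is a prefix-free machine that serves each
of them with a program that is longer by one than the size of the request. -/
theorem exists_machine_of_requests {r : Requests} (hr : Computable₂ r)
    (hw : ∀ x, weight r x ≤ 1) :
    ∃ V : Machine, IsPrefixFreeMachine V ∧
      ∀ x y n k, r x n = some (y, k) → ∃ p : Str, p.length = k + 1 ∧ y ∈ V p x := by
  let A : Str → ℕ → ℕ × ℕ := fun x n => acc (fun i => (r x i).map Prod.snd) n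
  have hA : ∀ x n, ((A x n).1 : ℝ) / (A x n).2 = weightBefore r x n := fun x n => acc_div_eq _ n
  -- The machine searches for a request that `p` serves and outputs its target; each trial `n` is
  -- decidable through `serves_iff`.
  let test : Str → Str → ℕ → Option Str := fun p x n => (r x n).bind fun s =>
    if p.length = s.2 + 1 ∧ (A x n).1 * 2 ^ (s.2 + 1) ≤ binVal p * (A x n).2 ∧
      binVal p * (A x n).2 < (A x n).1 * 2 ^ (s.2 + 1) + (A x n).2 then some s.1 else none
  have htest : ∀ p x n y, y ∈ test p x n ↔
      ∃ k, r x n = some (y, k) ∧ Serves (weightBefore r x n) k p := by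
    intro p x n y
    have hs : ∀ k, Serves (weightBefore r x n) k p ↔ p.length = k + 1 ∧
        (A x n).1 * 2 ^ (k + 1) ≤ binVal p * (A x n).2 ∧
        binVal p * (A x n).2 < (A x n).1 * 2 ^ (k + 1) + (A x n).2 := fun k => by
      rw [← hA, serves_iff (acc_snd_pos _ n)]
    simp only [test, hs]
    cases h : r x n with
    | none => simp
    | some s =>
      obtain ⟨y', k⟩ := s
      simp only [Option.bind_some, Option.mem_def, Option.ite_none_right_eq_some,
        Option.some.injEq, Prod.mk.injEq]
      exact ⟨fun h => ⟨k, ⟨h.2, rfl⟩, h.1⟩, fun ⟨_, h1, h2⟩ => ⟨h1.2 ▸ h2, h1.1⟩⟩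
  have hcomp : Computable₂ fun (q : Str × Str) n => test q.1 q.2 n := by
    have hAc : Computable₂ A := computable_acc (Computable.option_map hr
      (Computable.snd.comp Computable.snd))
    refine Computable.option_bind (f := fun q : (Str × Str) × ℕ => r q.1.2 q.2)
      (g := fun q s => if q.1.1.length = s.2 + 1 ∧
        (A q.1.2 q.2).1 * 2 ^ (s.2 + 1) ≤ binVal q.1.1 * (A q.1.2 q.2).2 ∧
        binVal q.1.1 * (A q.1.2 q.2).2 < (A q.1.2 q.2).1 * 2 ^ (s.2 + 1) + (A q.1.2 q.2).2
        then some s.1 else none)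
      (hr.comp (Computable.snd.comp Computable.fst) Computable.snd) ?_
    have hq : Computable fun q : ((Str × Str) × ℕ) × (Str × ℕ) => A q.1.1.2 q.1.2 :=
      hAc.comp (Computable.snd.comp (Computable.fst.comp Computable.fst))
        (Computable.snd.comp Computable.fst)
    have hp : Computable fun q : ((Str × Str) × ℕ) × (Str × ℕ) => q.1.1.1 :=
      Computable.fst.comp (Computable.fst.comp Computable.fst)
    have hk : Computable fun q : ((Str × Str) × ℕ) × (Str × ℕ) => q.2.2 + 1 :=
      Computable.succ.comp (Computable.snd.comp Computable.snd)
    have hl := Computable.nat_mul (Computable.fst.comp hq) (Computable.two_pow hk)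
    have hv := Computable.nat_mul (computable_binVal.comp hp) (Computable.snd.comp hq)
    have hdec := Computable.decide_and
        (Computable.decide_eq (Computable.list_length.comp hp) hk)
        (Computable.decide_and (Computable.decide_le hl hv)
          (Computable.decide_lt hv (Computable.nat_add hl (Computable.snd.comp hq))))
    exact (Computable.ite' hdec (Computable.option_some.comp (Computable.fst.comp Computable.snd))
      (Computable.const none)).of_eq fun q => by congr
  have hdom : ∀ p x y, y ∈ Nat.rfindOpt (test p x) →
      ∃ n k, r x n = some (y, k) ∧ Serves (weightBefore r x n) k p := by
    intro p x y h
    obtain ⟨n, hn⟩ := Nat.rfindOpt_spec h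
    exact ⟨n, (htest p x n y).1 hn⟩
  refine ⟨fun p x => Nat.rfindOpt (test p x), ⟨Partrec.rfindOpt hcomp, ?_⟩, ?_⟩
  · intro x p p' hpp hp hp'
    obtain ⟨y, hy⟩ := Part.dom_iff_mem.1 hp
    obtain ⟨y', hy'⟩ := Part.dom_iff_mem.1 hp'
    obtain ⟨n, k, h1, h2⟩ := hdom p x y hy
    obtain ⟨n', k', h1', h2'⟩ := hdom p' x y' hy'
    have := index_eq_of_serves hpp h1 h2 h1' h2'
    subst this
    obtain ⟨rfl, rfl⟩ : y = y' ∧ k = k' := by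
      rw [h1] at h1'
      simpa using h1'
    exact h2.unique h2'
  · intro x y n k h
    have hle := weightBefore_le_one (hw x) (n + 1)
    rw [weightBefore_succ h] at hle
    obtain ⟨p, hp⟩ := exists_serves (weightBefore_nonneg r x n) hle
    have hd : (Nat.rfindOpt (test p x)).Dom :=
      Nat.rfindOpt_dom.2 ⟨n, y, (htest p x n y).2 ⟨k, h, hp⟩⟩
    obtain ⟨y', hy'⟩ := Part.dom_iff_mem.1 hd
    obtain ⟨n', k', h1, h2⟩ := hdom p x y' hy'
    -- The search could a priori stop at another request, but a string serves at most one.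
    have := index_eq_of_serves List.prefix_rfl h hp h1 h2
    subst this
    rw [h] at h1
    obtain ⟨rfl, rfl⟩ : y = y' ∧ k = k' := by simpa using h1
    exact ⟨p, hp.1, hy'⟩

/-! ### The coding theorem -/

/-- The stream of requests of size `k + 1` that appear when the approximation exceeds
`2 ^ (-k)`. -/
def exceed (a : ℕ → ℕ) (i : ℕ) : Option ℕ :=
  if 2 ^ i.unpair.2 < a i.unpair.2 * 2 ^ i.unpair.1 ∧
      ¬ 2 ^ (i.unpair.2 - 1) < a (i.unpair.2 - 1) * 2 ^ i.unpair.1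
  then some (i.unpair.1 + 1) else none

theorem computable_exceed {α : Type*} [Primcodable α] {a : α → ℕ → ℕ} (ha : Computable₂ a) :
    Computable₂ fun x i => exceed (a x) i := by
  have hk : Computable fun p : α × ℕ => p.2.unpair.1 := Computable.unpair_fst Computable.snd
  have hn : Computable fun p : α × ℕ => p.2.unpair.2 := Computable.unpair_snd Computable.snd
  have h : ∀ f : α × ℕ → ℕ, Computable f →
      Computable fun p : α × ℕ => decide (2 ^ f p < a p.1 (f p) * 2 ^ p.2.unpair.1) :=
    fun f hf => Computable.decide_lt (Computable.two_pow hf)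
      (Computable.nat_mul (ha.comp Computable.fst hf) (Computable.two_pow hk))
  exact Computable.ite' (Computable.decide_and (h _ hn) (Computable.decide_not
    (h _ (Computable.nat_sub hn (Computable.const 1)))))
    (Computable.option_some.comp (Computable.succ.comp hk)) (Computable.const none)

theorem two_pow_lt_mul_iff (a n k : ℕ) :
    2 ^ n < a * 2 ^ k ↔ (2⁻¹ : ℝ≥0∞) ^ k < a * 2⁻¹ ^ n := by
  have h1 : ∀ m : ℕ, (2 : ℝ≥0∞) ^ m ≠ 0 := fun m => by positivity
  have h2 : ∀ m : ℕ, (2 : ℝ≥0∞) ^ m ≠ ∞ := fun m => by simp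
  rw [← ENNReal.inv_pow, ← ENNReal.inv_pow, ← div_eq_mul_inv,
    ENNReal.lt_div_iff_mul_lt (Or.inl (h1 n)) (Or.inl (h2 n)), mul_comm ((2 : ℝ≥0∞) ^ k)⁻¹,
    ← div_eq_mul_inv,
    ENNReal.div_lt_iff (Or.inl (h1 k)) (Or.inl (h2 k))]
  exact_mod_cast Iff.rfl

/-- Take the first stage at which the threshold is crossed. It is not stage `0` because `a 0 = 0`,
so the predecessor in `exceed` is a genuine earlier stage. -/
theorem DyadicApprox.exists_exceed {a : ℕ → ℕ} {v : ℝ≥0∞} (h : DyadicApprox a v) {k : ℕ}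
    (hk : 2⁻¹ ^ k < v) : ∃ i, exceed a i = some (k + 1) := by
  have hex : ∃ n, 2 ^ n < a n * 2 ^ k := by
    simp only [two_pow_lt_mul_iff]
    exact (h.2.2.eventually_const_lt hk).exists
  have hn := Nat.find_spec hex
  have h0 : Nat.find hex ≠ 0 := by
    intro h0
    rw [h0, h.1] at hn
    simp at hn
  refine ⟨Nat.pair k (Nat.find hex), ?_⟩
  unfold exceed
  simp only [Nat.unpair_pair]
  exact if_pos ⟨hn, Nat.find_min hex (by omega)⟩

/-- If `k₀` is the least index with `2 ^ (-k₀) < v`, the sum for `N > k₀` is `2 ^ (-k₀) - 2 ^ (-N)`.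
The extra summand `2 ^ (-N)` is what makes the induction close. -/
theorem sum_threshold_le (v : ℝ≥0∞) (N : ℕ) :
    ∑ k ∈ Finset.range N, (if 2⁻¹ ^ k < v then (2⁻¹ : ℝ≥0∞) ^ (k + 1) else 0) = 0 ∨
    ∑ k ∈ Finset.range N, (if 2⁻¹ ^ k < v then (2⁻¹ : ℝ≥0∞) ^ (k + 1) else 0) + 2⁻¹ ^ N ≤ v := by
  have hhalf : ∀ n : ℕ, (2⁻¹ : ℝ≥0∞) ^ (n + 1) + 2⁻¹ ^ (n + 1) = 2⁻¹ ^ n := fun n => by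
    rw [pow_succ, ← mul_add, ENNReal.inv_two_add_inv_two, mul_one]
  induction N with
  | zero => simp
  | succ N ih =>
    rw [Finset.sum_range_succ]
    by_cases h : (2⁻¹ : ℝ≥0∞) ^ N < v
    · rw [if_pos h]
      right
      rcases ih with h0 | h0
      · rw [h0, zero_add, hhalf]
        exact h.le
      · rwa [add_assoc, hhalf]
    · rw [if_neg h, add_zero]
      rcases ih with h0 | h0
      · exact Or.inl h0
      · right
        refine le_trans ?_ h0
        rw [← hhalf N]
        exact add_le_add_right le_self_add _

/-- For each `k` the approximation crosses `2 ^ (-k)` at most once, and only if `2 ^ (-k) < v`. The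
rest is the geometric bound of `sum_threshold_le`. -/
theorem DyadicApprox.tsum_exceed_le {a : ℕ → ℕ} {v : ℝ≥0∞} (h : DyadicApprox a v) :
    ∑' i, wt (exceed a i) ≤ v := by
  let e : ℕ → ℕ → ℝ≥0∞ := fun k n =>
    if 2 ^ n < a n * 2 ^ k ∧ ¬ 2 ^ (n - 1) < a (n - 1) * 2 ^ k then 2⁻¹ ^ (k + 1) else 0
  have h1 : ∑' i, wt (exceed a i) = ∑' k, ∑' n, e k n := by
    rw [← tsum_unpair e]
    refine tsum_congr fun i => ?_
    unfold exceed
    simp only [e]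
    split_ifs <;> rfl
  have hmono : ∀ k m n, m ≤ n → 2 ^ m < a m * 2 ^ k → 2 ^ n < a n * 2 ^ k := by
    intro k m n hmn hm
    rw [two_pow_lt_mul_iff] at *
    exact hm.trans_le (h.monotone hmn)
  have h2 : ∀ k, ∑' n, e k n ≤ if 2⁻¹ ^ k < v then 2⁻¹ ^ (k + 1) else 0 := by
    intro k
    by_cases hex : ∃ n, 2 ^ n < a n * 2 ^ k
    · have hk : (2⁻¹ : ℝ≥0∞) ^ k < v := by
        obtain ⟨n, hn⟩ := hex
        exact ((two_pow_lt_mul_iff _ _ _).1 hn).trans_le (h.le n)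
      rw [if_pos hk, tsum_eq_single (Nat.find hex)]
      · simp only [e]
        split_ifs <;> simp
      · intro n hn
        refine if_neg ?_
        rintro ⟨h3, h4⟩
        have h5 := Nat.find_min' hex h3
        exact h4 (hmono k (Nat.find hex) (n - 1) (by omega) (Nat.find_spec hex))
    · rw [ENNReal.tsum_eq_zero.2 fun n => if_neg fun h3 => hex ⟨n, h3.1⟩]
      exact zero_le
  rw [h1]
  refine (ENNReal.tsum_le_tsum h2).trans ?_
  rw [ENNReal.tsum_eq_iSup_nat]
  refine iSup_le fun N => ?_
  rcases sum_threshold_le v N with h0 | h0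
  · rw [h0]; exact zero_le
  · exact le_self_add.trans h0

/-- For every semimeasure there is a prefix-free machine that has a program of length `k + 2` for
`y` given `x` whenever the semimeasure of `y` given `x` exceeds `2 ^ (-k)`. -/
theorem IsCondSemimeasure.exists_machine {f : Str → Str → ℝ} (hf : IsCondSemimeasure f) :
    ∃ V : Machine, IsPrefixFreeMachine V ∧
      ∀ x y k, (2⁻¹ : ℝ) ^ k < f y x → ∃ p : Str, p.length = k + 2 ∧ y ∈ V p x := by
  obtain ⟨a, ha, h⟩ := hf.1.exists_dyadicApprox
  let q : Str × Str → ℕ → Option ℕ := fun p => exceed (a p)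
  have hw : ∀ x, weight (spread q) x ≤ 1 := fun x => by
    rw [← tsum_mass]
    refine le_trans (ENNReal.tsum_le_tsum fun y => ?_) (hf.tsum_ofReal_le x)
    rw [mass_spread]
    exact (h y x).tsum_exceed_le
  obtain ⟨V, hV, hreq⟩ := exists_machine_of_requests (computable_spread (computable_exceed ha)) hw
  refine ⟨V, hV, fun x y k hk => ?_⟩
  have hk' : (2⁻¹ : ℝ≥0∞) ^ k < ENNReal.ofReal (f y x) := by
    have h1 : (2⁻¹ : ℝ≥0∞) ^ k = ENNReal.ofReal (2⁻¹ ^ k) := by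
      rw [ENNReal.ofReal_pow (by norm_num), ENNReal.ofReal_inv_of_pos (by norm_num)]
      simp
    rw [h1]
    exact (ENNReal.ofReal_lt_ofReal_iff (lt_trans (by positivity) hk)).2 hk
  obtain ⟨j, hj⟩ := (h y x).exists_exceed hk'
  refine hreq x y (Nat.pair (encode y) j) (k + 1) ?_
  simp [spread, hj]

/-! ### Greedy allocation of intervals to the edges of a graph -/

/-- The size of a request if its edge satisfies `C`. -/
def sizeIf (C : Str × Str → Prop) [DecidablePred C] (o : Option ((Str × Str) × ℕ)) : Option ℕ :=
  o.bind fun s => if C s.1 then some s.2 else none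

/-- The string `v` is an endpoint of the edge `a`. -/
abbrev HasEnd (v : Str) (a : Str × Str) : Prop := a.1 = v ∨ a.2 = v

/-- Two edges have a common endpoint. -/
abbrev Meets (b a : Str × Str) : Prop := HasEnd b.1 a ∨ HasEnd b.2 a

/-- A position of level `n + 1` is blocked for the edge `a` if it is inside of an interval
that belongs to an edge that meets `a`. Here `(b, n', j)` says that the `j`-th interval of level
`n' + 1` belongs to `b`. -/
abbrev Blocked (st : List ((Str × Str) × (ℕ × ℕ))) (a : Str × Str) (n i : ℕ) : Prop :=
  ∃ s ∈ st, Meets a s.1 ∧ i / 2 ^ (n - s.2.1) = s.2.2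

/-- The positions of level `n + 1` that are free for the edge `a`. -/
def freePositions (st : List ((Str × Str) × (ℕ × ℕ))) (a : Str × Str) (n : ℕ) : List ℕ :=
  (List.range (2 ^ (n + 1))).filter fun i => ¬ Blocked st a n i

/-- The positions allocated to a request at step `n`; they fill one half of its weight. -/
def newPositions (st : List ((Str × Str) × (ℕ × ℕ))) (n : ℕ) (o : Option ((Str × Str) × ℕ)) :
    List ℕ :=
  o.elim [] fun s => (freePositions st s.1 n).take (2 ^ (n - s.2))

/-- The allocations before step `n`. -/
def allocated (e : ℕ → Option ((Str × Str) × ℕ)) : ℕ → List ((Str × Str) × (ℕ × ℕ))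
  | 0 => []
  | n + 1 => allocated e n ++ (e n).elim [] fun s =>
      (newPositions (allocated e n) n (e n)).map fun i => (s.1, (n, i))

/-- The positions allocated at step `n`. -/
def positions (e : ℕ → Option ((Str × Str) × ℕ)) (n : ℕ) : List ℕ :=
  newPositions (allocated e n) n (e n)

section Computability

theorem primrecRel_meets : PrimrecRel Meets := by
  have h : ∀ {f g : (Str × Str) × (Str × Str) → Str}, Primrec f → Primrec g →
      PrimrecPred fun p => f p = g p := fun hf hg => Primrec.eq.comp hf hg
  have a1 : Primrec fun p : (Str × Str) × (Str × Str) => p.1.1 := Primrec.fst.comp Primrec.fst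
  have a2 : Primrec fun p : (Str × Str) × (Str × Str) => p.1.2 := Primrec.snd.comp Primrec.fst
  have b1 : Primrec fun p : (Str × Str) × (Str × Str) => p.2.1 := Primrec.fst.comp Primrec.snd
  have b2 : Primrec fun p : (Str × Str) × (Str × Str) => p.2.2 := Primrec.snd.comp Primrec.snd
  exact ((h b1 a1).or (h b2 a1)).or ((h b1 a2).or (h b2 a2))

theorem primrec_two_pow : Primrec fun n : ℕ => 2 ^ n :=
  Primrec.nat_pow'.comp (Primrec.const 2) Primrec.id

theorem primrec_freePositions :
    Primrec fun p : List ((Str × Str) × (ℕ × ℕ)) × (Str × Str) × ℕ =>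
      freePositions p.1 p.2.1 p.2.2 := by
  have hrel : PrimrecRel fun (s : (Str × Str) × (ℕ × ℕ)) (q : (Str × Str) × ℕ × ℕ) =>
      Meets q.1 s.1 ∧ q.2.2 / 2 ^ (q.2.1 - s.2.1) = s.2.2 := by
    refine PrimrecPred.and (primrecRel_meets.comp (Primrec.fst.comp Primrec.snd)
      (Primrec.fst.comp Primrec.fst)) ?_
    refine Primrec.eq.comp (Primrec.nat_div.comp ?_ (primrec_two_pow.comp
      (Primrec.nat_sub.comp ?_ ?_))) ?_
    · exact Primrec.snd.comp (Primrec.snd.comp Primrec.snd)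
    · exact Primrec.fst.comp (Primrec.snd.comp Primrec.snd)
    · exact Primrec.fst.comp (Primrec.snd.comp Primrec.fst)
    · exact Primrec.snd.comp (Primrec.snd.comp Primrec.fst)
  have hfree : PrimrecRel fun (i : ℕ) (p : List ((Str × Str) × (ℕ × ℕ)) × (Str × Str) × ℕ) =>
      ¬ Blocked p.1 p.2.1 p.2.2 i := by
    refine PrimrecPred.not ?_
    refine PrimrecRel.comp (f := fun q : ℕ × (List ((Str × Str) × (ℕ × ℕ)) × (Str × Str) × ℕ) =>
      q.2.1) (g := fun q => (q.2.2.1, q.2.2.2, q.1)) hrel.exists_mem_list ?_ ?_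
    · exact Primrec.fst.comp Primrec.snd
    · exact Primrec.pair (Primrec.fst.comp (Primrec.snd.comp Primrec.snd))
        (Primrec.pair (Primrec.snd.comp (Primrec.snd.comp Primrec.snd)) Primrec.fst)
  exact hfree.listFilter.comp (Primrec.list_range.comp (primrec_two_pow.comp
    (Primrec.succ.comp (Primrec.snd.comp Primrec.snd)))) Primrec.id

theorem primrec_newPositions :
    Primrec fun p : List ((Str × Str) × (ℕ × ℕ)) × ℕ × Option ((Str × Str) × ℕ) =>
      newPositions p.1 p.2.1 p.2.2 := by
  refine (Primrec.option_casesOn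
    (o := fun p : List ((Str × Str) × (ℕ × ℕ)) × ℕ × Option ((Str × Str) × ℕ) => p.2.2)
    (f := fun _ => ([] : List ℕ))
    (g := fun p s => (freePositions p.1 s.1 p.2.1).take (2 ^ (p.2.1 - s.2)))
    (Primrec.snd.comp Primrec.snd) (Primrec.const []) ?_).of_eq ?_
  · have hn : Primrec fun q : (List ((Str × Str) × (ℕ × ℕ)) × ℕ × Option ((Str × Str) × ℕ)) ×
        ((Str × Str) × ℕ) => q.1.2.1 := Primrec.fst.comp (Primrec.snd.comp Primrec.fst)
    exact Primrec.list_take.comp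
      (primrec_two_pow.comp (Primrec.nat_sub.comp hn (Primrec.snd.comp Primrec.snd)))
      (primrec_freePositions.comp (Primrec.pair (Primrec.fst.comp Primrec.fst)
        (Primrec.pair (Primrec.fst.comp Primrec.snd) hn)))
  · rintro ⟨st, n, o⟩
    cases o <;> rfl

theorem computable_allocated {e : ℕ → Option ((Str × Str) × ℕ)} (he : Computable e) :
    Computable (allocated e) := by
  have hstep : Primrec fun p : List ((Str × Str) × (ℕ × ℕ)) × ℕ × Option ((Str × Str) × ℕ) =>
      p.1 ++ p.2.2.elim [] fun s =>
        (newPositions p.1 p.2.1 p.2.2).map fun i => (s.1, (p.2.1, i)) := by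
    refine Primrec.list_append.comp Primrec.fst ?_
    refine (Primrec.option_casesOn
      (o := fun p : List ((Str × Str) × (ℕ × ℕ)) × ℕ × Option ((Str × Str) × ℕ) => p.2.2)
      (f := fun _ => ([] : List ((Str × Str) × (ℕ × ℕ))))
      (g := fun p s => (newPositions p.1 p.2.1 p.2.2).map fun i => (s.1, (p.2.1, i)))
      (Primrec.snd.comp Primrec.snd) (Primrec.const []) ?_).of_eq ?_
    · refine Primrec.list_map (primrec_newPositions.comp Primrec.fst) ?_
      exact Primrec.pair (Primrec.fst.comp (Primrec.snd.comp Primrec.fst))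
        (Primrec.pair (Primrec.fst.comp (Primrec.snd.comp (Primrec.fst.comp Primrec.fst)))
          Primrec.snd)
    · rintro ⟨st, n, o⟩
      cases o <;> rfl
  refine (Computable.nat_rec (f := fun n : ℕ => n)
    (g := fun _ => ([] : List ((Str × Str) × (ℕ × ℕ))))
    (h := fun _ s => s.2 ++ (e s.1).elim [] fun t =>
        (newPositions s.2 s.1 (e s.1)).map fun i => (t.1, (s.1, i)))
    Computable.id (Computable.const []) ?_).of_eq ?_
  · have hn : Computable fun q : ℕ × (ℕ × List ((Str × Str) × (ℕ × ℕ))) => q.2.1 :=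
      Computable.fst.comp Computable.snd
    exact hstep.to_comp.comp (Computable.pair (Computable.snd.comp Computable.snd)
      (Computable.pair hn (he.comp hn)))
  · intro n
    induction n with
    | zero => rfl
    | succ n ih => rw [allocated, ← ih]

theorem computable_positions {e : ℕ → Option ((Str × Str) × ℕ)} (he : Computable e) :
    Computable (positions e) :=
  primrec_newPositions.to_comp.comp
    (Computable.pair (computable_allocated he) (Computable.pair Computable.id he))

end Computability

/-! ### Counting free positions in the greedy allocation. -/

theorem mem_allocated {e : ℕ → Option ((Str × Str) × ℕ)} {N : ℕ} {b : Str × Str} {n i : ℕ} :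
    (b, (n, i)) ∈ allocated e N ↔ n < N ∧ (∃ k, e n = some (b, k)) ∧ i ∈ positions e n := by
  induction N with
  | zero => simp [allocated]
  | succ N ih =>
    rw [allocated, List.mem_append, ih]
    constructor
    · rintro (h | h)
      · exact ⟨by omega, h.2⟩
      · cases hN : e N with
        | none => simp [hN] at h
        | some s =>
          rw [hN, Option.elim, List.mem_map] at h
          obtain ⟨j, hj, heq⟩ := h
          simp only [Prod.mk.injEq] at heq
          obtain ⟨rfl, rfl, rfl⟩ := heq
          refine ⟨by omega, ⟨s.2, hN⟩, ?_⟩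
          rw [positions, hN]
          exact hj
    · rintro ⟨hn, ⟨k, hk⟩, hi⟩
      rcases Nat.lt_succ_iff_lt_or_eq.1 hn with h | rfl
      · exact Or.inl ⟨h, ⟨k, hk⟩, hi⟩
      · right
        rw [hk, Option.elim, List.mem_map]
        refine ⟨i, ?_, rfl⟩
        rw [← hk]
        exact hi

theorem positions_eq {e : ℕ → Option ((Str × Str) × ℕ)} {n k : ℕ} {a : Str × Str}
    (h : e n = some (a, k)) :
    positions e n = (freePositions (allocated e n) a n).take (2 ^ (n - k)) := by
  rw [positions, newPositions, h]
  rfl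

theorem mem_freePositions_of_mem {e : ℕ → Option ((Str × Str) × ℕ)} {n k i : ℕ} {a : Str × Str}
    (h : e n = some (a, k)) (hi : i ∈ positions e n) :
    i < 2 ^ (n + 1) ∧ ¬ Blocked (allocated e n) a n i := by
  rw [positions_eq h] at hi
  have := List.mem_of_mem_take hi
  simpa [freePositions] using this

theorem nodup_positions (e : ℕ → Option ((Str × Str) × ℕ)) (n : ℕ) : (positions e n).Nodup := by
  cases h : e n with
  | none => simp [positions, newPositions, h]
  | some s =>
    rw [positions_eq (show e n = some (s.1, s.2) from h)]
    exact (List.take_sublist _ _).nodup (List.nodup_range.filter _)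

theorem length_positions_le {e : ℕ → Option ((Str × Str) × ℕ)} {n k : ℕ} {a : Str × Str}
    (h : e n = some (a, k)) : (positions e n).length ≤ 2 ^ (n - k) := by
  rw [positions_eq h, List.length_take]
  exact min_le_left _ _

theorem card_div_eq_le (M D j : ℕ) (hD : 0 < D) :
    ((Finset.range M).filter fun i => i / D = j).card ≤ D := by
  have : (Finset.range M).filter (fun i => i / D = j) ⊆ Finset.Ico (j * D) (j * D + D) := by
    intro i hi
    obtain ⟨-, rfl⟩ := Finset.mem_filter.1 hi
    rw [Finset.mem_Ico]
    exact ⟨Nat.div_mul_le_self i D, Nat.lt_div_mul_add hD⟩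
  simpa using Finset.card_le_card this

/-- The measure, times two, of the intervals that block the edge `a`. -/
noncomputable def blockedWeight (st : List ((Str × Str) × (ℕ × ℕ))) (a : Str × Str) : ℝ≥0∞ :=
  (st.map fun s => if Meets a s.1 then (2⁻¹ : ℝ≥0∞) ^ s.2.1 else 0).sum

/-- Since no earlier interval is finer than the current level, each one is covered by `2 ^ (n - n')`
current positions; the union bound does the rest. -/
theorem card_blocked_le (st : List ((Str × Str) × (ℕ × ℕ))) (a : Str × Str) (n : ℕ)
    (hst : ∀ s ∈ st, s.2.1 ≤ n) :
    (((Finset.range (2 ^ (n + 1))).filter fun i => Blocked st a n i).card : ℝ≥0∞) ≤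
      2 ^ n * blockedWeight st a := by
  induction st with
  | nil => simp
  | cons s st ih =>
    have ih' := ih fun t ht => hst t (List.mem_cons_of_mem _ ht)
    have hs := hst s List.mem_cons_self
    rw [blockedWeight, List.map_cons, List.sum_cons, mul_add, ← blockedWeight]
    have hsub : (Finset.range (2 ^ (n + 1))).filter (fun i => Blocked (s :: st) a n i) ⊆
        (Finset.range (2 ^ (n + 1))).filter
          (fun i => Meets a s.1 ∧ i / 2 ^ (n - s.2.1) = s.2.2) ∪
        (Finset.range (2 ^ (n + 1))).filter fun i => Blocked st a n i := by
      intro i hi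
      rw [Finset.mem_filter] at hi
      obtain ⟨hi, t, ht, h⟩ := hi
      rw [Finset.mem_union, Finset.mem_filter, Finset.mem_filter]
      rcases List.mem_cons.1 ht with rfl | ht
      · exact Or.inl ⟨hi, h⟩
      · exact Or.inr ⟨hi, t, ht, h⟩
    have hcard := (Finset.card_le_card hsub).trans (Finset.card_union_le _ _)
    have hfst : (((Finset.range (2 ^ (n + 1))).filter
        fun i => Meets a s.1 ∧ i / 2 ^ (n - s.2.1) = s.2.2).card : ℝ≥0∞) ≤
        2 ^ n * if Meets a s.1 then (2⁻¹ : ℝ≥0∞) ^ s.2.1 else 0 := by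
      split_ifs with hm
      · simp only [hm, true_and]
        have h1 : (2 : ℝ≥0∞) ^ n * 2⁻¹ ^ s.2.1 = ((2 ^ (n - s.2.1) : ℕ) : ℝ≥0∞) := by
          push_cast
          conv_lhs => rw [← Nat.sub_add_cancel hs]
          rw [pow_add, mul_assoc, two_pow_mul_inv, mul_one]
        rw [h1, Nat.cast_le]
        exact card_div_eq_le _ _ _ (by positivity)
      · simp [hm]
    calc _ ≤ (_ : ℝ≥0∞) := Nat.cast_le.2 hcard
      _ ≤ _ := by
        rw [Nat.cast_add]
        exact add_le_add hfst ih'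

/-- A request of size `k` at step `N` takes at most `2 ^ (N - k)` positions, each counted with `2 ^
(-N)`, hence at most its own weight `2 ^ (-k)`. -/
theorem blockedWeight_allocated_le {e : ℕ → Option ((Str × Str) × ℕ)}
    (he : ∀ n a k, e n = some (a, k) → k ≤ n) (a : Str × Str) (N : ℕ) :
    blockedWeight (allocated e N) a ≤
      ∑ n ∈ Finset.range N, wt (sizeIf (Meets a) (e n)) := by
  induction N with
  | zero => simp [blockedWeight, allocated]
  | succ N ih =>
    rw [Finset.sum_range_succ, allocated, blockedWeight, List.map_append, List.sum_append,
      ← blockedWeight]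
    refine add_le_add ih ?_
    cases h : e N with
    | none => simp
    | some s =>
      obtain ⟨b, k⟩ := s
      rw [Option.elim, List.map_map, ← h]
      change ((positions e N).map fun _ => if Meets a b then (2⁻¹ : ℝ≥0∞) ^ N else 0).sum ≤ _
      rw [h, List.map_const', List.sum_replicate, nsmul_eq_mul]
      simp only [sizeIf, Option.bind_some]
      split_ifs with hm
      · have h1 : ((positions e N).length : ℝ≥0∞) ≤ 2 ^ (N - k) := by
          exact_mod_cast length_positions_le h
        calc ((positions e N).length : ℝ≥0∞) * 2⁻¹ ^ N ≤ 2 ^ (N - k) * 2⁻¹ ^ N := by gcongr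
          _ = 2 ^ (N - k) * 2⁻¹ ^ (N - k) * 2⁻¹ ^ k := by
              conv_lhs => rw [← Nat.sub_add_cancel (he N b k h)]
              rw [Nat.add_sub_cancel, pow_add, mul_assoc]
          _ = wt (some k) := by rw [two_pow_mul_inv, one_mul, wt_some]
      · simp

theorem wt_sizeIf_meets_le (a : Str × Str) (o : Option ((Str × Str) × ℕ)) :
    wt (sizeIf (Meets a) o) ≤ wt (sizeIf (HasEnd a.1) o) + wt (sizeIf (HasEnd a.2) o) := by
  cases o with
  | none => simp [sizeIf]
  | some s =>
    simp only [sizeIf, Option.bind_some]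
    by_cases h1 : HasEnd a.1 s.1
    · rw [if_pos h1, if_pos (Or.inl h1)]
      exact le_self_add
    · by_cases h2 : HasEnd a.2 s.1
      · rw [if_pos h2, if_pos (Or.inr h2)]
        exact le_add_self
      · rw [if_neg (not_or.2 ⟨h1, h2⟩)]
        simp

/-- The greedy algorithm never runs out of free positions. -/
theorem length_positions {e : ℕ → Option ((Str × Str) × ℕ)}
    (he : ∀ n a k, e n = some (a, k) → k ≤ n)
    (hload : ∀ v, ∑' n, wt (sizeIf (HasEnd v) (e n)) ≤ 1) {n k : ℕ} {a : Str × Str}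
    (h : e n = some (a, k)) : (positions e n).length = 2 ^ (n - k) := by
  rw [positions_eq h, List.length_take]
  refine min_eq_left ?_
  have hk := he n a k h
  -- The load bound at an endpoint includes the current request, so the earlier ones leave room `2 ^
  -- (-k)`.
  have hend : ∀ v, HasEnd v a →
      ∑ i ∈ Finset.range n, wt (sizeIf (HasEnd v) (e i)) + 2⁻¹ ^ k ≤ 1 := by
    intro v hv
    refine le_trans (le_of_eq ?_) ((ENNReal.sum_le_tsum (Finset.range (n + 1))).trans (hload v))
    rw [Finset.sum_range_succ, h]
    simp [sizeIf, hv]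
  -- Adds the bounds at the two endpoints. An edge touching both, or a loop, is counted twice, which
  -- only weakens the bound.
  have hw : blockedWeight (allocated e n) a + (2⁻¹ ^ k + 2⁻¹ ^ k) ≤ 2 := by
    calc blockedWeight (allocated e n) a + (2⁻¹ ^ k + 2⁻¹ ^ k)
        ≤ (∑ i ∈ Finset.range n, wt (sizeIf (HasEnd a.1) (e i)) +
          ∑ i ∈ Finset.range n, wt (sizeIf (HasEnd a.2) (e i))) + (2⁻¹ ^ k + 2⁻¹ ^ k) := by
          gcongr
          refine (blockedWeight_allocated_le he a n).trans ?_
          rw [← Finset.sum_add_distrib]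
          exact Finset.sum_le_sum fun i _ => wt_sizeIf_meets_le a (e i)
      _ = (∑ i ∈ Finset.range n, wt (sizeIf (HasEnd a.1) (e i)) + 2⁻¹ ^ k) +
          (∑ i ∈ Finset.range n, wt (sizeIf (HasEnd a.2) (e i)) + 2⁻¹ ^ k) := by
          rw [add_add_add_comm]
      _ ≤ 1 + 1 := add_le_add (hend _ (Or.inl rfl)) (hend _ (Or.inr rfl))
      _ = 2 := one_add_one_eq_two
  have hb := card_blocked_le (allocated e n) a n fun s hs => by
    obtain ⟨b, m, i⟩ := s
    exact (mem_allocated.1 hs).1.le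
  have hfree : (freePositions (allocated e n) a n).length =
      ((Finset.range (2 ^ (n + 1))).filter fun i => ¬ Blocked (allocated e n) a n i).card := rfl
  have hsum := Finset.card_filter_add_card_filter_not (s := Finset.range (2 ^ (n + 1)))
    (fun i => Blocked (allocated e n) a n i)
  rw [Finset.card_range] at hsum
  -- In units of level `n + 1` the whole space has `2 ^ (n + 1)` positions and `2 ^ (n - k)` of them
  -- are wanted; the estimate would even leave twice as many free.
  have hkey : ((Finset.range (2 ^ (n + 1))).filter
      fun i => Blocked (allocated e n) a n i).card + 2 ^ (n - k) ≤ 2 ^ (n + 1) := by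
    rw [← Nat.cast_le (α := ℝ≥0∞)]
    push_cast
    have h1 : (2 : ℝ≥0∞) ^ (n - k) = 2 ^ n * 2⁻¹ ^ k := by
      conv_rhs => rw [← Nat.sub_add_cancel hk]
      rw [pow_add, mul_assoc, two_pow_mul_inv, mul_one]
    calc _ ≤ 2 ^ n * blockedWeight (allocated e n) a + 2 ^ n * (2⁻¹ ^ k + 2⁻¹ ^ k) := by
          refine add_le_add hb ?_
          rw [h1]
          gcongr
          exact le_self_add
      _ ≤ 2 ^ n * 2 := by rw [← mul_add]; gcongr
      _ = 2 ^ (n + 1) := (pow_succ _ _).symm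
  omega

/-! ### The machine of an allocation -/

/-- The endpoint of `a` that is opposite to `x`. -/
def otherEnd (a : Str × Str) (x : Str) : Option Str :=
  if a.1 = x then some a.2 else if a.2 = x then some a.1 else none

theorem otherEnd_eq_some {a : Str × Str} {x y : Str} :
    otherEnd a x = some y ↔ a = (x, y) ∨ a = (y, x) := by
  obtain ⟨a1, a2⟩ := a
  unfold otherEnd
  simp only [Prod.mk.injEq]
  split_ifs with h1 h2
  · subst h1
    simp only [Option.some.injEq, true_and]
    exact ⟨Or.inl, fun h => h.elim id fun h => h.2.trans h.1⟩
  · subst h2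
    simp [h1]
  · simp [h1, h2]

/-- The total function that sends the strings allocated to an edge, together with one of its
endpoints, to the other endpoint. -/
def edgeMap (e : ℕ → Option ((Str × Str) × ℕ)) (p x : Str) : Option Str :=
  if 0 < p.length ∧ binVal p ∈ positions e (p.length - 1) then
    (e (p.length - 1)).bind fun s => otherEnd s.1 x
  else none

theorem edgeMap_eq_some {e : ℕ → Option ((Str × Str) × ℕ)} {p x y : Str} :
    edgeMap e p x = some y ↔ ∃ n, p.length = n + 1 ∧ binVal p ∈ positions e n ∧
      ∃ a k, e n = some (a, k) ∧ (a = (x, y) ∨ a = (y, x)) := by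
  simp only [edgeMap, Option.ite_none_right_eq_some, Option.bind_eq_some_iff, otherEnd_eq_some]
  constructor
  · rintro ⟨⟨h0, h1⟩, s, h2, h3⟩
    exact ⟨p.length - 1, by omega, h1, s.1, s.2, h2, h3⟩
  · rintro ⟨n, hn, h1, a, k, h2, h3⟩
    rw [hn, Nat.add_sub_cancel]
    exact ⟨⟨by omega, h1⟩, (a, k), h2, h3⟩

theorem computable_edgeMap {e : ℕ → Option ((Str × Str) × ℕ)} (he : Computable e) :
    Computable₂ (edgeMap e) := by
  have hl : Computable fun p : Str × Str => p.1.length := Computable.list_length.comp Computable.fst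
  have hn : Computable fun p : Str × Str => p.1.length - 1 :=
    Computable.nat_sub hl (Computable.const 1)
  have hmem : PrimrecRel fun (L : List ℕ) (i : ℕ) => ∃ j ∈ L, j = i :=
    PrimrecRel.exists_mem_list Primrec.eq
  have hmem' : Computable fun p : Str × Str =>
      decide (binVal p.1 ∈ positions e (p.1.length - 1)) :=
    (hmem.decide.to_comp.comp ((computable_positions he).comp hn)
      (computable_binVal.comp Computable.fst)).of_eq fun p => by simp
  have hother : Primrec₂ otherEnd := by
    have a1 : Primrec fun p : (Str × Str) × Str => p.1.1 := Primrec.fst.comp Primrec.fst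
    have a2 : Primrec fun p : (Str × Str) × Str => p.1.2 := Primrec.snd.comp Primrec.fst
    exact Primrec.ite (Primrec.eq.comp a1 Primrec.snd) (Primrec.option_some.comp a2)
      (Primrec.ite (Primrec.eq.comp a2 Primrec.snd) (Primrec.option_some.comp a1)
        (Primrec.const none))
  refine Computable.ite' (Computable.decide_and (Computable.decide_lt (Computable.const 0) hl)
    hmem') ?_ (Computable.const none)
  exact Computable.option_bind (he.comp hn) (hother.to_comp.comp
    (Computable.fst.comp Computable.snd) (Computable.snd.comp Computable.fst))

/-- The machine that computes `edgeMap`. -/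
def edgeMachine (e : ℕ → Option ((Str × Str) × ℕ)) : Machine := fun p x => edgeMap e p x

theorem mem_edgeMachine {e : ℕ → Option ((Str × Str) × ℕ)} {p x y : Str} :
    y ∈ edgeMachine e p x ↔ edgeMap e p x = some y := by
  rw [edgeMachine, Part.mem_coe, Option.mem_def]

theorem mem_edgeMachine_comm {e : ℕ → Option ((Str × Str) × ℕ)} {p x y : Str} :
    y ∈ edgeMachine e p x ↔ x ∈ edgeMachine e p y := by
  simp only [mem_edgeMachine, edgeMap_eq_some]
  simp only [or_comm]

/-- Two programs halting on `x` belong to edges that share the endpoint `x`. If their lengths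
differ, the longer one was chosen later and avoided everything below the shorter one; if they agree,
a prefix is an equality. -/
theorem prefixFree_edgeMachine (e : ℕ → Option ((Str × Str) × ℕ)) :
    PrefixFree (edgeMachine e) := by
  intro x p p' hpp hp hp'
  obtain ⟨y, hy⟩ := Part.dom_iff_mem.1 hp
  obtain ⟨y', hy'⟩ := Part.dom_iff_mem.1 hp'
  obtain ⟨n, hn, hv, a, k, ha, hax⟩ := edgeMap_eq_some.1 (mem_edgeMachine.1 hy)
  obtain ⟨n', hn', hv', a', k', ha', hax'⟩ := edgeMap_eq_some.1 (mem_edgeMachine.1 hy')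
  have hle := hpp.length_le
  rcases Nat.lt_or_ge n n' with hlt | hge
  · exfalso
    refine (mem_freePositions_of_mem ha' hv').2 ⟨(a, (n, binVal p)),
      mem_allocated.2 ⟨hlt, ⟨k, ha⟩, hv⟩, ?_, ?_⟩
    · rcases hax with rfl | rfl <;> rcases hax' with rfl | rfl <;> simp [Meets, HasEnd]
    · have := binVal_div_of_prefix hpp
      rwa [show p'.length - p.length = n' - n by omega] at this
  · exact hpp.eq_of_length (by omega)

theorem isPrefixFreeMachine_edgeMachine {e : ℕ → Option ((Str × Str) × ℕ)} (he : Computable e) :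
    IsPrefixFreeMachine (edgeMachine e) :=
  ⟨Computable.ofOption (computable_edgeMap he), prefixFree_edgeMachine e⟩

theorem mapsEvent_edgeMachine_comm (e : ℕ → Option ((Str × Str) × ℕ)) (x y : Str) :
    mapsEvent (edgeMachine e) x y = mapsEvent (edgeMachine e) y x := by
  ext π
  unfold mapsEvent
  exact exists_congr fun p => and_congr_right fun _ => mem_edgeMachine_comm

/-- Whatever program leads from `x` to `y` also leads back, so the intersection costs nothing. -/
theorem backForthEvent_edgeMachine (e : ℕ → Option ((Str × Str) × ℕ)) (x y : Str) :
    backForthEvent (edgeMachine e) x y = mapsEvent (edgeMachine e) x y := by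
  rw [backForthEvent, mapsEvent_edgeMachine_comm e y x, Set.inter_self]

theorem uniformlyEffectivelyOpen_edgeMachine {e : ℕ → Option ((Str × Str) × ℕ)}
    (he : Computable e) : UniformlyEffectivelyOpen (mapsEvent (edgeMachine e)) := by
  refine ⟨fun q => edgeMap e q.2.2 q.1 = some q.2.1, ?_, fun x y => ?_⟩
  · refine ComputablePred.to_re ⟨inferInstance, Computable.decide_eq ?_ ?_⟩
    · exact (computable_edgeMap he).comp (Computable.snd.comp Computable.snd) Computable.fst
    · exact Computable.option_some.comp (Computable.fst.comp Computable.snd)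
  · ext π
    simp only [mapsEvent, mem_edgeMachine, Set.mem_ofPred_eq, Set.mem_iUnion, exists_prop]
    exact exists_congr fun p => and_comm

theorem tsum_binVal_mem (N : ℕ) (c : ℝ≥0∞) (L : List ℕ) (hnd : L.Nodup)
    (hL : ∀ i ∈ L, i < 2 ^ N) :
    ∑' p : Str, (if p.length = N ∧ binVal p ∈ L then c else 0) = L.length * c := by
  induction L with
  | nil => simp
  | cons i L ih =>
    rw [List.nodup_cons] at hnd
    have hsplit : ∀ p : Str, (if p.length = N ∧ binVal p ∈ i :: L then c else 0) =
        (if p.length = N ∧ binVal p = i then c else 0) +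
        if p.length = N ∧ binVal p ∈ L then c else 0 := by
      intro p
      by_cases h1 : p.length = N
      · by_cases h2 : binVal p = i
        · simp [h1, h2, hnd.1]
        · simp [h1, h2]
      · simp [h1]
    obtain ⟨p, hp, hv⟩ := exists_binVal_eq N i (hL i List.mem_cons_self)
    rw [tsum_congr hsplit, ENNReal.tsum_add,
      ih hnd.2 fun j hj => hL j (List.mem_cons_of_mem _ hj), tsum_eq_single p, if_pos ⟨hp, hv⟩,
      List.length_cons]
    · push_cast
      ring
    · intro p' hne
      exact if_neg fun h => hne (binVal_injective (h.1.trans hp.symm) (h.2.trans hv.symm))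

/-- The event of an edge has one half of the weight of the requests for this edge. -/
theorem coinMeasure_edgeMachine {e : ℕ → Option ((Str × Str) × ℕ)}
    (he : ∀ n a k, e n = some (a, k) → k ≤ n)
    (hload : ∀ v, ∑' n, wt (sizeIf (HasEnd v) (e n)) ≤ 1) (x y : Str) :
    coinMeasure (mapsEvent (edgeMachine e) x y) =
      2⁻¹ * ∑' n, wt (sizeIf (fun a => a = (x, y) ∨ a = (y, x)) (e n)) := by
  classical
  let C : Str × Str → Prop := fun a => a = (x, y) ∨ a = (y, x)
  let E : ℕ → Prop := fun n => ∃ a k, e n = some (a, k) ∧ C a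
  let F : ℕ → Str → ℝ≥0∞ := fun n p =>
    if p.length = n + 1 ∧ binVal p ∈ positions e n then (if E n then 2⁻¹ ^ (n + 1) else 0) else 0
  have h1 : ∀ p : Str, (if y ∈ edgeMachine e p x then (2⁻¹ : ℝ≥0∞) ^ p.length else 0) =
      ∑' n, F n p := by
    intro p
    rw [mem_edgeMachine, edgeMap_eq_some, tsum_eq_single (p.length - 1)]
    · simp only [F]
      by_cases h : ∃ n, p.length = n + 1 ∧ binVal p ∈ positions e n ∧
          ∃ a k, e n = some (a, k) ∧ (a = (x, y) ∨ a = (y, x))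
      · rw [if_pos h]
        obtain ⟨n, hn, hv, hE⟩ := h
        rw [hn, Nat.add_sub_cancel, if_pos ⟨rfl, hv⟩, if_pos hE]
      · rw [if_neg h]
        split_ifs with h2 h3
        · exact absurd ⟨_, h2.1, h2.2, h3⟩ h
        · rfl
        · rfl
    · intro n hn
      exact if_neg fun h => hn (by omega)
  have h2 : ∀ n, ∑' p, F n p = 2⁻¹ * wt (sizeIf C (e n)) := by
    intro n
    simp only [F]
    cases h : e n with
    | none =>
      have : ¬ E n := by rintro ⟨a, k, h', -⟩; simp [h] at h'
      simp [this, sizeIf]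
    | some s =>
      obtain ⟨a, k⟩ := s
      rw [tsum_binVal_mem _ _ _ (nodup_positions e n) fun i hi =>
        (mem_freePositions_of_mem h hi).1, length_positions he hload h]
      by_cases hC : C a
      · have : E n := ⟨a, k, h, hC⟩
        rw [if_pos this]
        simp only [sizeIf, Option.bind_some, if_pos hC, wt_some]
        push_cast
        conv_lhs => rw [← Nat.sub_add_cancel (he n a k h)]
        rw [Nat.add_sub_cancel, pow_succ, pow_add, ← mul_assoc, ← mul_assoc, two_pow_mul_inv,
          one_mul, mul_comm]
      · have : ¬ E n := by
          rintro ⟨a', k', h', hC'⟩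
          rw [h] at h'
          cases h'
          exact hC hC'
        simp [this, sizeIf, hC]
  rw [coinMeasure_mapsEvent (prefixFree_edgeMachine e), tsum_congr h1, ENNReal.tsum_comm,
    tsum_congr h2, ENNReal.tsum_mul_left]

/-! ### Edges weighted by a symmetric function -/

/-- The requests of all the streams `q a` for the edges `a` with ordered endpoints. -/
def edgeRequests (q : Str × Str → ℕ → Option ℕ) (i : ℕ) : Option ((Str × Str) × ℕ) :=
  (decode₂ (Str × Str) i.unpair.1).bind fun a =>
    if encode a.1 ≤ encode a.2 then (q a i.unpair.2).map fun k => (a, k) else none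

theorem computable_edgeRequests {q : Str × Str → ℕ → Option ℕ} (hq : Computable₂ q) :
    Computable (edgeRequests q) := by
  refine Computable.option_bind (g := fun (i : ℕ) (a : Str × Str) =>
    if encode a.1 ≤ encode a.2 then (q a i.unpair.2).map fun k => (a, k) else none)
    (Primrec.decode₂.to_comp.comp (Computable.unpair_fst Computable.id)) ?_
  refine Computable.ite' (c := fun p : ℕ × (Str × Str) => encode p.2.1 ≤ encode p.2.2)
    (Computable.decide_le
    (Computable.encode.comp (Computable.fst.comp Computable.snd))
    (Computable.encode.comp (Computable.snd.comp Computable.snd))) ?_ (Computable.const none)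
  refine Computable.option_map (g := fun (p : ℕ × (Str × Str)) k => (p.2, k)) ?_ ?_
  · exact hq.comp Computable.snd (Computable.unpair_snd Computable.fst)
  · exact Computable.pair (Computable.snd.comp Computable.fst) Computable.snd

theorem tsum_edgeRequests (q : Str × Str → ℕ → Option ℕ) (C : Str × Str → Prop)
    [DecidablePred C] :
    ∑' i, wt (sizeIf C (edgeRequests q i)) =
      ∑' a : Str × Str, if encode a.1 ≤ encode a.2 ∧ C a then ∑' j, wt (q a j) else 0 := by
  unfold edgeRequests
  rw [tsum_unpair fun n j => wt (sizeIf C ((decode₂ (Str × Str) n).bind fun a =>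
    if encode a.1 ≤ encode a.2 then (q a j).map fun k => (a, k) else none)),
    ← tsum_decode₂ fun a : Str × Str =>
      if encode a.1 ≤ encode a.2 ∧ C a then ∑' j, wt (q a j) else 0]
  refine tsum_congr fun n => ?_
  cases decode₂ (Str × Str) n with
  | none => simp [sizeIf]
  | some a =>
    simp only [Option.bind_some, Option.elim]
    by_cases h1 : encode a.1 ≤ encode a.2
    · by_cases h2 : C a
      · rw [if_pos ⟨h1, h2⟩]
        refine tsum_congr fun j => ?_
        cases h : q a j <;> simp [sizeIf, h1, h2]
      · rw [if_neg fun h => h2 h.2]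
        refine ENNReal.tsum_eq_zero.2 fun j => ?_
        cases h : q a j <;> simp [sizeIf, h1, h2]
    · simp [h1, sizeIf]

/-- Edges at `v` are split by whether `v` is the first or the second endpoint in the order of codes.
The second case uses a strict inequality, so that the loop at `v` is counted once. -/
theorem tsum_ordered_hasEnd_le {w : Str × Str → ℝ≥0∞} (hw : ∀ x y, w (x, y) = w (y, x))
    (v : Str) :
    ∑' a : Str × Str, (if encode a.1 ≤ encode a.2 ∧ HasEnd v a then w a else 0) ≤
      ∑' y, w (v, y) := by
  have h1 : ∀ a : Str × Str, (if encode a.1 ≤ encode a.2 ∧ HasEnd v a then w a else 0) ≤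
      (if a.1 = v then (if encode v ≤ encode a.2 then w (v, a.2) else 0) else 0) +
      (if a.2 = v then (if encode a.1 < encode v then w (v, a.1) else 0) else 0) := by
    rintro ⟨x, y⟩
    by_cases h : encode x ≤ encode y ∧ HasEnd v (x, y)
    · rw [if_pos h]
      obtain ⟨hle, hend⟩ := h
      by_cases hx : x = v
      · subst hx
        simp [hle]
      · have hy : y = v := hend.resolve_left hx
        subst hy
        have hlt : encode x < encode y := lt_of_le_of_ne hle fun h => hx (encode_injective h)
        simp [hx, hlt, hw x y]
    · rw [if_neg h]
      exact zero_le
  refine (ENNReal.tsum_le_tsum h1).trans (le_of_eq ?_)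
  rw [ENNReal.tsum_add, ENNReal.tsum_prod (f := fun x y =>
    if x = v then (if encode v ≤ encode y then w (v, y) else 0) else 0),
    ENNReal.tsum_prod (f := fun x y =>
    if y = v then (if encode x < encode v then w (v, x) else 0) else 0),
    ENNReal.tsum_comm (f := fun x y =>
    if x = v then (if encode v ≤ encode y then w (v, y) else 0) else 0)]
  simp only [tsum_ite_eq]
  rw [← ENNReal.tsum_add]
  refine tsum_congr fun y => ?_
  by_cases h : encode v ≤ encode y
  · simp [h, not_lt.2 h]
  · simp [h, not_le.1 h]

/-- Exactly one of the two orientations survives the ordering condition, so an undirected edge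
carries its weight once. -/
theorem tsum_ordered_eq {w : Str × Str → ℝ≥0∞} (hw : ∀ x y, w (x, y) = w (y, x)) (x y : Str) :
    ∑' a : Str × Str,
      (if encode a.1 ≤ encode a.2 ∧ (a = (x, y) ∨ a = (y, x)) then w a else 0) = w (x, y) := by
  wlog h : encode x ≤ encode y generalizing x y
  · rw [hw x y, ← this y x (not_le.1 h).le]
    simp only [or_comm]
  rw [tsum_eq_single (x, y), if_pos ⟨h, Or.inl rfl⟩]
  intro a ha
  refine if_neg ?_
  rintro ⟨hle, rfl | rfl⟩
  · exact ha rfl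
  · exact ha (by rw [encode_injective (le_antisymm h hle)])

/-- Effectively open sets of measure `min (m x y) (m y x) / 2` that are the events of a
prefix-free machine. -/
theorem IsCondSemimeasure.exists_edgeMachine {m : Str → Str → ℝ} (hm : IsCondSemimeasure m) :
    ∃ e : ℕ → Option ((Str × Str) × ℕ), Computable e ∧
      ∀ x y, coinMeasure.real (mapsEvent (edgeMachine e) x y) = min (m x y) (m y x) / 2 := by
  obtain ⟨a, ha, happ⟩ := hm.1.exists_dyadicApprox
  let b : Str × Str → ℕ → ℕ := fun p n => min (a (p.1, p.2) n) (a (p.2, p.1) n)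
  let w : Str × Str → ℝ≥0∞ := fun p =>
    min (ENNReal.ofReal (m p.1 p.2)) (ENNReal.ofReal (m p.2 p.1))
  have hw : ∀ x y, w (x, y) = w (y, x) := fun x y => min_comm _ _
  have hb : Computable₂ b := by
    have h1 : Computable fun p : (Str × Str) × ℕ => p.1.1 := Computable.fst.comp Computable.fst
    have h2 : Computable fun p : (Str × Str) × ℕ => p.1.2 := Computable.snd.comp Computable.fst
    exact Primrec.nat_min.to_comp.comp (ha.comp (Computable.pair h1 h2) Computable.snd)
      (ha.comp (Computable.pair h2 h1) Computable.snd)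
  have hincr : ∀ p, ∑' j, wt (incr (b p) j) = w p := fun p =>
    ((happ p.1 p.2).inf (happ p.2 p.1)).tsum_incr
  let e := edgeRequests fun p => incr (b p)
  have he : ∀ n c k, e n = some (c, k) → k ≤ n := by
    intro n c k h
    simp only [e, edgeRequests, Option.bind_eq_some_iff, Option.ite_none_right_eq_some,
      Option.map_eq_some_iff, Prod.mk.injEq] at h
    obtain ⟨_, -, -, j, hj, -, rfl⟩ := h
    exact (le_of_incr_eq_some hj).trans (Nat.unpair_right_le n)
  have hload : ∀ v, ∑' n, wt (sizeIf (HasEnd v) (e n)) ≤ 1 := by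
    intro v
    rw [tsum_edgeRequests]
    simp only [hincr]
    -- Of the two terms of the minimum, the one conditioned on the vertex `v` is kept: these sum to
    -- at most `1` over `y`.
    refine (tsum_ordered_hasEnd_le hw v).trans (le_trans ?_ (hm.tsum_ofReal_le v))
    exact ENNReal.tsum_le_tsum fun y => min_le_right _ _
  refine ⟨e, computable_edgeRequests (computable_incr hb), fun x y => ?_⟩
  rw [Measure.real, coinMeasure_edgeMachine he hload, tsum_edgeRequests]
  simp only [hincr]
  rw [tsum_ordered_eq hw, ENNReal.toReal_mul, ENNReal.toReal_inv, ENNReal.toReal_ofNat]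
  simp only [w]
  rw [← ENNReal.ofReal_min, ENNReal.toReal_ofReal (le_min (hm.2.1 x y) (hm.2.1 y x))]
  ring

/-! ### Complexity -/

theorem condComplexity_le {V : Machine} {p x y : Str} (h : y ∈ V p x) :
    condComplexity V y x ≤ p.length :=
  iInf₂_le p h

theorem exists_program {V : Machine} {x y : Str} {k : ℕ} (h : condComplexity V y x = k) :
    ∃ p : Str, y ∈ V p x ∧ p.length = k := by
  have hlt : condComplexity V y x < ((k + 1 : ℕ) : ℕ∞) := by
    rw [h]
    exact_mod_cast Nat.lt_succ_self k
  obtain ⟨p, hp⟩ := iInf_lt_iff.1 hlt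
  obtain ⟨hy, hp⟩ := iInf_lt_iff.1 hp
  refine ⟨p, hy, le_antisymm (Nat.lt_succ_iff.1 (by exact_mod_cast hp)) ?_⟩
  have := condComplexity_le hy
  rw [h] at this
  exact_mod_cast this

theorem IsMaximalCondSemimeasure.exists_mapsEvent_le {m : Str → Str → ℝ}
    (hm : IsMaximalCondSemimeasure m) {U : Machine} (hU : IsPrefixFreeMachine U) :
    ∃ c : ℝ, 0 < c ∧ ∀ x y, coinMeasure.real (mapsEvent U x y) ≤ c * m y x := by
  obtain ⟨c, hc, h⟩ := hm.2 _ hU.isCondSemimeasure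
  exact ⟨c, hc, fun x y => h y x⟩

theorem IsMaximalCondSemimeasure.exists_pow_le {m : Str → Str → ℝ}
    (hm : IsMaximalCondSemimeasure m) {V : Machine} (hV : IsPrefixFreeMachine V) :
    ∃ c : ℝ, 0 < c ∧ ∀ x y (k : ℕ), condComplexity V y x = k → (2⁻¹ : ℝ) ^ k ≤ c * m y x := by
  obtain ⟨c, hc, h⟩ := hm.exists_mapsEvent_le hV
  refine ⟨c, hc, fun x y k hk => ?_⟩
  obtain ⟨p, hp, rfl⟩ := exists_program hk
  exact (pow_length_le_coinMeasure hp).trans (h x y)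

theorem IsCondSemimeasure.exists_condComplexity_le {m : Str → Str → ℝ}
    (hm : IsCondSemimeasure m) :
    ∃ V : Machine, IsPrefixFreeMachine V ∧
      ∀ x y (k : ℕ), (2⁻¹ : ℝ) ^ k < m y x → condComplexity V y x ≤ (k + 2 : ℕ) := by
  obtain ⟨V, hV, h⟩ := hm.exists_machine
  refine ⟨V, hV, fun x y k hk => ?_⟩
  obtain ⟨p, hp, hy⟩ := h x y k hk
  exact hp ▸ condComplexity_le hy

/-- A machine built from a maximal `m` is optimal: a program of length `k` on another machine forces
`2 ^ (-k) ≤ c * m(y|x)`, and with `c < 2 ^ d` this gives a program of length `k + d + 2`. -/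
theorem exists_isComplexityOptimal : ∃ V, IsComplexityOptimal V := by
  obtain ⟨m, hm⟩ := exists_isMaximalCondSemimeasure
  obtain ⟨V, hV, h⟩ := hm.1.exists_condComplexity_le
  refine ⟨V, hV, fun V' hV' => ?_⟩
  obtain ⟨c, hc, h'⟩ := hm.exists_pow_le hV'
  obtain ⟨d, hd⟩ := pow_unbounded_of_one_lt c (one_lt_two)
  refine ⟨d + 2, fun x y => ?_⟩
  rcases eq_or_ne (condComplexity V' y x) ⊤ with htop | htop
  · simp [htop]
  · obtain ⟨k, hk⟩ := ENat.ne_top_iff_exists.1 htop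
    have h1 := h' x y k hk.symm
    have h2 : (2⁻¹ : ℝ) ^ (k + d) < m y x := by
      have h3 : (2⁻¹ : ℝ) ^ k < 2 ^ d * m y x :=
        h1.trans_lt (mul_lt_mul_of_pos_right hd (hm.pos y x))
      rw [pow_add]
      have h4 : (2 : ℝ) ^ d * 2⁻¹ ^ d = 1 := by rw [← mul_pow]; norm_num
      calc (2⁻¹ : ℝ) ^ k * 2⁻¹ ^ d < 2 ^ d * m y x * 2⁻¹ ^ d := by gcongr
        _ = m y x * (2 ^ d * 2⁻¹ ^ d) := by ring
        _ = m y x := by rw [h4, mul_one]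
    rw [← hk]
    exact_mod_cast h x y (k + d) h2

/-! ### Comparison of the probability with the semimeasure -/

/-- The joint event is contained in each one-directional event, and both of these have probabilities
dominated by `m`. -/
theorem IsMaximalCondSemimeasure.exists_backForthProb_le {m : Str → Str → ℝ}
    (hm : IsMaximalCondSemimeasure m) {U : Machine} (hU : IsPrefixFreeMachine U) :
    ∃ c : ℝ, 0 < c ∧ ∀ x y, backForthProb U x y ≤ c * min (m x y) (m y x) := by
  obtain ⟨c, hc, h⟩ := hm.exists_mapsEvent_le hU
  refine ⟨c, hc, fun x y => ?_⟩
  rw [mul_min_of_nonneg _ _ hc.le]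
  refine le_min ?_ ?_
  · rw [backForthProb_comm]
    exact (backForthProb_le U y x).trans (h y x)
  · exact (backForthProb_le U x y).trans (h x y)

theorem IsCondSemimeasure.exists_backForthProb_eq {m : Str → Str → ℝ}
    (hm : IsCondSemimeasure m) :
    ∃ W : Machine, IsPrefixFreeMachine W ∧
      ∀ x y, backForthProb W x y = min (m x y) (m y x) / 2 := by
  obtain ⟨e, he, h⟩ := hm.exists_edgeMachine
  refine ⟨edgeMachine e, isPrefixFreeMachine_edgeMachine he, fun x y => ?_⟩
  rw [backForthProb, backForthEvent_edgeMachine, h]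

theorem exists_isBackForthOptimal : ∃ U, IsBackForthOptimal U := by
  obtain ⟨m, hm⟩ := exists_isMaximalCondSemimeasure
  obtain ⟨W, hW, h⟩ := hm.1.exists_backForthProb_eq
  refine ⟨W, hW, fun U hU => ?_⟩
  obtain ⟨c, hc, h'⟩ := hm.exists_backForthProb_le hU
  refine ⟨2 * c, by positivity, fun x y => ?_⟩
  rw [h]
  linarith [h' x y]

theorem IsBackForthOptimal.exists_min_le {U : Machine} (hU : IsBackForthOptimal U)
    {m : Str → Str → ℝ} (hm : IsCondSemimeasure m) :
    ∃ c : ℝ, 0 < c ∧ ∀ x y, min (m x y) (m y x) ≤ c * backForthProb U x y := by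
  obtain ⟨W, hW, h⟩ := hm.exists_backForthProb_eq
  obtain ⟨c, hc, h'⟩ := hU.2 W hW
  refine ⟨2 * c, by positivity, fun x y => ?_⟩
  have := h' x y
  rw [h] at this
  linarith

/-- The negative logarithm of the probability equals the maximum of the two complexities. -/
theorem exists_abs_neg_logb_sub_le {U V : Machine} (hU : IsBackForthOptimal U)
    (hV : IsComplexityOptimal V) :
    ∃ c : ℝ, ∀ x y : Str,
      0 < backForthProb U x y ∧
      max (condComplexity V x y) (condComplexity V y x) ≠ ⊤ ∧
      |-Real.logb 2 (backForthProb U x y) -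
        ((max (condComplexity V x y) (condComplexity V y x)).toNat : ℝ)| ≤ c := by
  obtain ⟨m, hm⟩ := exists_isMaximalCondSemimeasure
  obtain ⟨c₁, hc₁, h₁⟩ := hm.exists_backForthProb_le hU.1
  obtain ⟨c₂, hc₂, h₂⟩ := hU.exists_min_le hm.1
  obtain ⟨c₃, hc₃, h₃⟩ := hm.exists_pow_le hV.1
  obtain ⟨V', hV', h₄⟩ := hm.1.exists_condComplexity_le
  obtain ⟨d, hd⟩ := hV.2 V' hV'
  refine ⟨|Real.logb 2 (c₃ * c₂)| + |Real.logb 2 (2 * c₁)| + (2 + d), fun x y => ?_⟩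
  have hu : 0 < min (m x y) (m y x) := lt_min (hm.pos x y) (hm.pos y x)
  have hu1 : min (m x y) (m y x) ≤ 1 := (min_le_left _ _).trans (hm.1.le_one x y)
  have he : 0 < backForthProb U x y := pos_of_mul_pos_right (hu.trans_le (h₂ x y)) hc₂.le
  have hex : ∃ k : ℕ, (2⁻¹ : ℝ) ^ k < min (m x y) (m y x) :=
    exists_pow_lt_of_lt_one hu (by norm_num)
  -- The least such `k` equals `-log u(x, y)` up to a bounded error; both complexities are then at
  -- most `k + 2 + d` by the coding theorem.
  obtain ⟨k, hk, hk2⟩ : ∃ k : ℕ, (2⁻¹ : ℝ) ^ k < min (m x y) (m y x) ∧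
      min (m x y) (m y x) ≤ 2 * 2⁻¹ ^ k := by
    refine ⟨Nat.find hex, Nat.find_spec hex, ?_⟩
    rcases Nat.eq_zero_or_eq_succ_pred (Nat.find hex) with h0 | h0
    · rw [h0]
      norm_num at hu1 ⊢
      rcases hu1 with h | h
      · exact Or.inl (by linarith)
      · exact Or.inr (by linarith)
    · have h5 := Nat.find_min hex (m := (Nat.find hex).pred) (by omega)
      rw [h0, pow_succ]
      linarith
  have hle : ∀ x y : Str, (2⁻¹ : ℝ) ^ k < m y x →
      condComplexity V y x ≤ ((k + 2 + d : ℕ) : ℕ∞) := by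
    intro x y h
    refine (hd x y).trans ?_
    rw [Nat.cast_add]
    exact add_le_add_left (h₄ x y k h) _
  have hxy := hle x y (hk.trans_le (min_le_right _ _))
  have hyx := hle y x (hk.trans_le (min_le_left _ _))
  obtain ⟨a, ha⟩ := ENat.ne_top_iff_exists.1 (ne_top_of_le_ne_top (ENat.natCast_ne_top _) hyx)
  obtain ⟨b, hb⟩ := ENat.ne_top_iff_exists.1 (ne_top_of_le_ne_top (ENat.natCast_ne_top _) hxy)
  have hmax : max (condComplexity V x y) (condComplexity V y x) = ((max a b : ℕ) : ℕ∞) := by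
    rw [← ha, ← hb]
    exact ((Nat.mono_cast (α := ℕ∞)).map_max (a := a) (b := b)).symm
  rw [← ha] at hyx
  rw [← hb] at hxy
  have hM : max a b ≤ k + 2 + d := max_le (by exact_mod_cast hyx) (by exact_mod_cast hxy)
  refine ⟨he, by rw [hmax]; exact ENat.natCast_ne_top _, ?_⟩
  rw [hmax, ENat.toNat_natCast]
  have hlogpow : ∀ n : ℕ, Real.logb 2 ((2⁻¹ : ℝ) ^ n) = -n := fun n => by
    rw [Real.logb_pow, Real.logb_inv, Real.logb_self_eq_one (by norm_num)]
    ring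
  have hpow : ∀ n : ℕ, (0 : ℝ) < 2⁻¹ ^ n := fun n => by positivity
  -- The larger complexity corresponds to the smaller of the two bounds `2 ^ (-KP) ≤ c₃ * m`, so its
  -- power of two lies below `c₃` times the minimum.
  have hup : (2⁻¹ : ℝ) ^ (max a b) ≤ c₃ * c₂ * backForthProb U x y := by
    have h5 : (2⁻¹ : ℝ) ^ (max a b) ≤ c₃ * min (m x y) (m y x) := by
      rw [mul_min_of_nonneg _ _ hc₃.le]
      refine le_min ?_ ?_
      · exact (pow_le_pow_of_le_one (by norm_num) (by norm_num) (le_max_left a b)).trans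
          (h₃ y x a ha.symm)
      · exact (pow_le_pow_of_le_one (by norm_num) (by norm_num) (le_max_right a b)).trans
          (h₃ x y b hb.symm)
    rw [mul_assoc]
    exact h5.trans (by gcongr; exact h₂ x y)
  have hlow : backForthProb U x y ≤ 2 * c₁ * 2⁻¹ ^ k := by
    calc backForthProb U x y ≤ c₁ * (2 * 2⁻¹ ^ k) := (h₁ x y).trans (by gcongr)
      _ = _ := by ring
  have l1 := Real.logb_le_logb_of_le (one_lt_two) (hpow _) hup
  rw [hlogpow, Real.logb_mul (by positivity) he.ne'] at l1
  have l2 := Real.logb_le_logb_of_le (one_lt_two) he hlow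
  rw [Real.logb_mul (by positivity) (hpow k).ne', hlogpow] at l2
  have hM' : ((max a b : ℕ) : ℝ) ≤ k + 2 + d := by exact_mod_cast hM
  have b1 := le_abs_self (Real.logb 2 (c₃ * c₂))
  have b2 := le_abs_self (Real.logb 2 (2 * c₁))
  have b3 := abs_nonneg (Real.logb 2 (c₃ * c₂))
  have b4 := abs_nonneg (Real.logb 2 (2 * c₁))
  have b5 : (0 : ℝ) ≤ d := by positivity
  rw [abs_le]
  constructor <;> linarith

end InfoDist

theorem mainTheorem6 :
    -- optimal machines and maximal conditional semimeasures exist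
    (∃ U : InfoDist.Machine, InfoDist.IsBackForthOptimal U) ∧
    (∃ V : InfoDist.Machine, InfoDist.IsComplexityOptimal V) ∧
    (∃ m : InfoDist.Str → InfoDist.Str → ℝ, InfoDist.IsMaximalCondSemimeasure m) ∧
    -- `- log e(x, y) = max (KP(x | y), KP(y | x)) + O(1)`, both sides being finite
    (∀ U V : InfoDist.Machine,
      InfoDist.IsBackForthOptimal U → InfoDist.IsComplexityOptimal V →
      ∃ c : ℝ, ∀ x y : InfoDist.Str,
        0 < InfoDist.backForthProb U x y ∧
        max (InfoDist.condComplexity V x y) (InfoDist.condComplexity V y x) ≠ ⊤ ∧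
        |-Real.logb 2 (InfoDist.backForthProb U x y) -
          ((max (InfoDist.condComplexity V x y) (InfoDist.condComplexity V y x)).toNat : ℝ)|
            ≤ c) ∧
    -- `e(x, y) = min (m(x | y), m(y | x))` up to a constant factor
    (∀ (U : InfoDist.Machine) (m : InfoDist.Str → InfoDist.Str → ℝ),
      InfoDist.IsBackForthOptimal U → InfoDist.IsMaximalCondSemimeasure m →
      ∃ c : ℝ, 0 < c ∧ ∀ x y : InfoDist.Str,
        InfoDist.backForthProb U x y ≤ c * min (m x y) (m y x) ∧
        min (m x y) (m y x) ≤ c * InfoDist.backForthProb U x y) ∧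
    -- the effectively open sets of measure exactly `u(x, y) / 2`, and a machine that has them
    -- as its events
    (∀ m : InfoDist.Str → InfoDist.Str → ℝ, InfoDist.IsMaximalCondSemimeasure m →
      ∃ S : InfoDist.Str → InfoDist.Str → Set InfoDist.Cantor,
        InfoDist.UniformlyEffectivelyOpen S ∧
        (∀ x y, S x y = S y x) ∧
        (∀ x y z, y ≠ z → Disjoint (S x y) (S x z)) ∧
        (∀ x y, InfoDist.coinMeasure.real (S x y) = min (m x y) (m y x) / 2) ∧
        ∃ W : InfoDist.Machine, InfoDist.IsPrefixFreeMachine W ∧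
          ∀ x y, InfoDist.backForthEvent W x y = S x y) := by
  refine ⟨InfoDist.exists_isBackForthOptimal, InfoDist.exists_isComplexityOptimal,
    InfoDist.exists_isMaximalCondSemimeasure,
    fun U V hU hV => InfoDist.exists_abs_neg_logb_sub_le hU hV, fun U m hU hm => ?_,
    fun m hm => ?_⟩
  · obtain ⟨c₁, hc₁, h₁⟩ := hm.exists_backForthProb_le hU.1
    obtain ⟨c₂, hc₂, h₂⟩ := hU.exists_min_le hm.1
    refine ⟨max c₁ c₂, lt_max_of_lt_left hc₁, fun x y => ⟨(h₁ x y).trans ?_, (h₂ x y).trans ?_⟩⟩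
    · exact mul_le_mul_of_nonneg_right (le_max_left _ _) (le_min (hm.1.2.1 x y) (hm.1.2.1 y x))
    · exact mul_le_mul_of_nonneg_right (le_max_right _ _) measureReal_nonneg
  · obtain ⟨e, he, h⟩ := hm.1.exists_edgeMachine
    exact ⟨InfoDist.mapsEvent (InfoDist.edgeMachine e),
      InfoDist.uniformlyEffectivelyOpen_edgeMachine he,
      InfoDist.mapsEvent_edgeMachine_comm e,
      fun x _ _ hne => InfoDist.disjoint_mapsEvent (InfoDist.prefixFree_edgeMachine e) x hne, h,
      InfoDist.edgeMachine e, InfoDist.isPrefixFreeMachine_edgeMachine he,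
      InfoDist.backForthEvent_edgeMachine e⟩
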